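/- **Theorem (VOSS inequality).** *Setting.* Let $S$ be a measurable state space and $A\subset\mathbb R^n$ a measurable action set with $0<\mu(A)<\infty$ ($\mu$ Lebesgue measure). Let $T(s,a)$ be a Markov transition kernel, $R(s,a)$ a measurable reward with $|R|\le R_{\max}$ on $S\times A$, $\gamma\in[0,1)$, $V_{\max}=R_{\max}/(1-\gamma)$, and $D$ a finite horizon. Put $V^\star_D=0$, $Q^\star_d(s,a)=R(s,a)+\gamma\,\mathbb E_{s'\sim T(s,a)}V^\star_{d+1}(s')$ and $V^\star_d(s)=\sup_{a\in A}Q^\star_d(s,a)$ for $d<D$. Let $\delta$ be a measurable translation-invariant semi-metric on $A$ such that for each $r>0$ the relative volume $\mu(\{x\in A:\delta(x,a)<r\})/\mu(A)$ is bounded below by a positive constant independent of $a\in A$. Let $\omega\in(0,1]$, and suppose that for some $L>0$ and all $d<D$, $s\in S$ there is a global maximizer $a^*\in A$ of $Q^\star_d(s,\cdot)$ with $Q^\star_d(s,a^*)-Q^\star_d(s,a)\le L\,\delta(a,a^*)$ for all $a\in A$. *VOSS.* Fix widths $C_a,C_s\ge1$. The estimate $\hat V_{\mathrm{VOSS},d}(s)$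 is $0$ if $d=D$. If $d<D$, actions $a_1,\dots,a_{C_a}$ are drawn sequentially by VOO: $a_1$ is uniform on $A$; for $i>1$, with probability $\omega$ the action $a_i$ is uniform on $A$, and with probability $1-\omega$ it is uniform on the Voronoi cell $\{a\in A:\delta(a,a_b)\le\delta(a,a_j)\ \forall j<i\}$, where $b<i$ is the first index maximizing $\hat Q_{\mathrm{VOSS},d}(s,a_j)$ over $j<i$ (uniform on $A$ if this cell is null). After each $a_i$ is drawn, independent next states $s'_{i,1},\dots,s'_{i,C_s}\sim T(s,a_i)$ are drawn, with independent recursive estimates, and $\hat Q_{\mathrm{VOSS},d}(s,a_i)=R(s,a_i)+\frac{\gamma}{C_s}\sum_k\hat V_{\mathrm{VOSS},d+1}(s'_{i,k})$. Finally $\hat V_{\mathrm{VOSS},d}(s)=\max_i\hat Q_{\mathrm{VOSS},d}(s,a_i)$. With the same actions let $\hat V^{C_a}_D=0$, $\hat Q_d(s,a)=R(s,a)+\gamma\,\mathbb E_{s'\sim T(s,a)}[\hat V^{C_a}_{d+1}(s')]$ (expectation over $s'$ and over the randomness of the algorithm started at $s'$), and $\hat V^{C_a}_d(s)=\max_i\hat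 Q_d(s,a_i)$. For $\rho\in\mathbb R$, $\varepsilon\ge0$, $p\in\mathbb R$ consider the conditions * (VOO regret $\rho$) $\mathbb E\big[\sup_{a\in A}\hat Q_d(s,a)-\hat V^{C_a}_d(s)\big]\le\rho$ for all $d<D$, $s\in S$; * (concentration $(\varepsilon,p)$) for all $d<D$, $s\in S$, with probability at least $1-p$, at every node (state $x$, depth $e\ge d$) of the search tree started from $s$ at depth $d$ and for every action $a_i$ chosen there, $\big|\frac1{C_s}\sum_k\hat V^{C_a}_{e+1}(x'_{i,k})-\mathbb E_{x'\sim T(x,a_i)}[\hat V^{C_a}_{e+1}(x')]\big|\le\varepsilon$, where $x'_{i,1},\dots,x'_{i,C_s}$ are the next states sampled for $a_i$. *Conclusions.* The VOSS search tree has a well-defined probability law for all widths $C_a,C_s\ge 1$, and: 1. Suppose $C_a,C_s\ge1$ are such that (VOO regret $\rho$) and (concentration $(\varepsilon,p)$) hold, with $\varepsilon\ge0$. Let $\eta_{C_a}(d)\ge\gamma\,\eta_{C_a}(d+1)+\rho$ for $d<D$, $\eta_{C_a}(D)=0$, and let $\alpha_{C_s}(D-1)=\varepsilon+2pV_{\max}$,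 $\alpha_{C_s}(d)=\gamma(\alpha_{C_s}(d+1)+\varepsilon+2pV_{\max})$ for $d<D-1$. Put $\eta_{C_a}=\max_{d<D}\eta_{C_a}(d)$ and $\alpha_{C_s}=\max_{d<D}\alpha_{C_s}(d)$. Then for all $d\in\{0,\dots,D-1\}$ and $s\in S$, $|V^\star_d(s)-\hat V_{\mathrm{VOSS},d}(s)|$ is integrable and $$\mathbb E\,\big|V^\star_d(s)-\hat V_{\mathrm{VOSS},d}(s)\big|\le\eta_{C_a}+\alpha_{C_s}.$$ 2. For all $C_a,C_s\ge1$ and $\varepsilon>0$, (concentration $(\varepsilon,p)$) holds whenever $V_{\max}\neq0$ and $p\ge 2N\exp\!\big(-2\varepsilon^2C_s/(2V_{\max})^2\big)$, where $N=\sum_{j=0}^{D-1}C_a(C_aC_s)^j$; if $V_{\max}=0$ it holds whenever $p\ge 2N$. 3. There are numbers $\rho_{C_a}$ and sequences $\eta_{C_a}(\cdot)$ depending only on $C_a$ (not on $C_s$), and $\varepsilon,p\ge0$ depending on $(C_a,C_s)$ with $\alpha_{C_s}(\cdot)$ given by the recursion in 1 (so $\alpha_{C_s}$ may also depend on $C_a$),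 such that for all $C_a,C_s\ge1$ all the hypotheses of 1 hold, and both terms tend to $0$ as the widths grow: $\eta_{C_a}\to0$ as $C_a\to\infty$, and $\alpha_{C_s}\to0$ along every sequence of widths with $C_s\to\infty$ and $\log C_a/C_s\to0$ (in particular for every fixed $C_a$). -/

import Mathlib

open MeasureTheory ProbabilityTheory Filter Topology

noncomputable section

namespace VOSS

universe u

/-- The ambient Euclidean space of the continuous action set. -/
abbrev Action (n : ℕ) : Type := EuclideanSpace ℝ (Fin n)

/-- The data of a Markov decision process with action set `A ⊆ ℝⁿ`, transition law `T (s, a)`,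
reward `R s a` and discount factor `γ`. Values of `T` and `R` at actions outside `A` play no role. -/
structure MDP (S : Type u) [MeasurableSpace S] (n : ℕ) where
  A : Set (Action n)
  T : Kernel (S × Action n) S
  R : S → Action n → ℝ
  γ : ℝ

/-- The sparse-sampling regularity conditions: a continuous action set of positive finite volume,
genuine transition probabilities, a measurable reward bounded by `Rmax`, and `γ ∈ [0, 1)`. -/
structure MDP.Regular {S : Type u} [MeasurableSpace S] {n : ℕ} (M : MDP S n) (Rmax : ℝ) :
    Prop where
  measurableSet_A : MeasurableSet M.A
  volume_pos : 0 < volume M.A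
  volume_lt_top : volume M.A < ⊤
  markov : IsMarkovKernel M.T
  measurable_R : Measurable fun x : S × Action n => M.R x.1 x.2
  bounded_R : ∀ s, ∀ a ∈ M.A, |M.R s a| ≤ Rmax
  γ_nonneg : 0 ≤ M.γ
  γ_lt_one : M.γ < 1

/-- `Vmax = Rmax / (1 - γ)`. -/
def MDP.Vmax {S : Type u} [MeasurableSpace S] {n : ℕ} (M : MDP S n) (Rmax : ℝ) : ℝ :=
  Rmax / (1 - M.γ)

/-- One-step lookahead: `R(s,a) + γ 𝔼_{s' ∼ T(s,a)} v(s')`. -/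
def MDP.lookahead {S : Type u} [MeasurableSpace S] {n : ℕ} (M : MDP S n) (v : S → ℝ)
    (s : S) (a : Action n) : ℝ :=
  M.R s a + M.γ * ∫ s', v s' ∂(M.T (s, a))

/-- The optimal value function with `h` steps to go. With horizon `D`, the optimal value at
depth `d` is `M.vStar (D - d)`, and `M.vStar 0 = 0` is the value at depth `D`. -/
def MDP.vStar {S : Type u} [MeasurableSpace S] {n : ℕ} (M : MDP S n) : ℕ → S → ℝ
  | 0, _ => 0
  | h + 1, s => ⨆ a : M.A, M.lookahead (M.vStar h) s a

/-- The optimal action value function at depth `d` for horizon `D`. -/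
def MDP.qStar {S : Type u} [MeasurableSpace S] {n : ℕ} (M : MDP S n) (D d : ℕ)
    (s : S) (a : Action n) : ℝ :=
  M.lookahead (M.vStar (D - (d + 1))) s a

/-- A translation-invariant semi-metric on `A` (the triangle inequality is not required). -/
structure IsTransInvSemimetric {n : ℕ} (A : Set (Action n)) (δ : Action n → Action n → ℝ) :
    Prop where
  nonneg : ∀ x ∈ A, ∀ y ∈ A, 0 ≤ δ x y
  symm : ∀ x ∈ A, ∀ y ∈ A, δ x y = δ y x
  eq_zero_iff : ∀ x ∈ A, ∀ y ∈ A, (δ x y = 0 ↔ x = y)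
  translate : ∀ x ∈ A, ∀ y ∈ A, ∀ z, x + z ∈ A → y + z ∈ A → δ (x + z) (y + z) = δ x y

/-- The VOO regularity conditions that are used: `δ` is a (measurable) translation-invariant
semi-metric, the relative volume of a `δ`-ball of given radius is bounded away from `0`, the
exploration probability `ω` is positive, and at every depth and state the optimal action value
function has a global maximizer `a*` with `Q(a*) - Q(a) ≤ L δ(a, a*)`. -/
structure VOORegular {S : Type u} [MeasurableSpace S] {n : ℕ} (M : MDP S n) (D : ℕ)
    (δ : Action n → Action n → ℝ) (ω L : ℝ) : Prop where
  measurable_dist : Measurable fun x : Action n × Action n => δ x.1 x.2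
  semimetric : IsTransInvSemimetric M.A δ
  ball_volume : ∀ r : ℝ, 0 < r → ∃ c : ENNReal, 0 < c ∧
    ∀ a ∈ M.A, c * volume M.A ≤ volume {x ∈ M.A | δ x a < r}
  ω_pos : 0 < ω
  ω_le_one : ω ≤ 1
  smooth : 0 < L ∧ ∀ d < D, ∀ s, ∃ a' ∈ M.A, ∀ a ∈ M.A,
    M.qStar D d s a ≤ M.qStar D d s a' ∧ M.qStar D d s a' - M.qStar D d s a ≤ L * δ a a'

/-- `i` is the best index for the values `q` (the earliest one among ties). -/
def IsBest {k : ℕ} (q : Fin k → ℝ) (i : Fin k) : Prop :=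
  (∀ j, q j ≤ q i) ∧ ∀ j, j < i → q j < q i

/-- The Voronoi cell, in `A`, of the `i`-th of the centers `c`. -/
def voronoiCell {n : ℕ} (A : Set (Action n)) (δ : Action n → Action n → ℝ) {k : ℕ}
    (c : Fin k → Action n) (i : Fin k) : Set (Action n) :=
  {a ∈ A | ∀ j, δ a (c i) ≤ δ a (c j)}

open scoped Classical in
/-- The uniform law on the `i`-th Voronoi cell, i.e. the output law of uniform rejection sampling.
(For a cell of volume zero, where rejection sampling does not stop, it is the uniform law on `A`.) -/
def cellLaw {n : ℕ} (A : Set (Action n)) (δ : Action n → Action n → ℝ) {k : ℕ}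
    (c : Fin k → Action n) (i : Fin k) : Measure (Action n) :=
  if volume (voronoiCell A δ c i) = 0 then cond volume A
  else cond volume (voronoiCell A δ c i)

open scoped Classical in
/-- The law of the next VOO action given the earlier actions `c` and their estimated values `q`:
uniform on `A` if there is no earlier action; otherwise uniform on `A` with probability `ω`, and
uniform on the Voronoi cell of the best earlier action with probability `1 - ω`. -/
def vooLaw {n : ℕ} (A : Set (Action n)) (δ : Action n → Action n → ℝ) (ω : ℝ) {k : ℕ}
    (c : Fin k → Action n) (q : Fin k → ℝ) : Measure (Action n) :=
  if k = 0 then cond volume A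
  else ENNReal.ofReal ω • cond volume A +
    ENNReal.ofReal (1 - ω) • ∑ i, if IsBest q i then cellLaw A δ c i else 0

/-- The search trees with `h` steps to go: a node carries `Ca` actions, and each action carries
`Cs` sampled next states, each with its own subtree. -/
def Tree (S : Type u) (n Ca Cs : ℕ) : ℕ → Type u
  | 0 => PUnit
  | h + 1 => Fin Ca → Action n × (Fin Cs → S × Tree S n Ca Cs h)

/-- An action together with its `Cs` sampled next states and their subtrees. -/
abbrev Branch (S : Type u) (n Ca Cs h : ℕ) : Type u :=
  Action n × (Fin Cs → S × Tree S n Ca Cs h)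

/-- Product σ-algebra on trees. -/
@[reducible] def Tree.measurableSpace (S : Type u) [MeasurableSpace S] (n Ca Cs : ℕ) :
    (h : ℕ) → MeasurableSpace (Tree S n Ca Cs h)
  | 0 => (inferInstance : MeasurableSpace PUnit)
  | h + 1 =>
    letI := Tree.measurableSpace S n Ca Cs h
    (inferInstance : MeasurableSpace (Fin Ca → Branch S n Ca Cs h))

instance (S : Type u) [MeasurableSpace S] (n Ca Cs h : ℕ) :
    MeasurableSpace (Tree S n Ca Cs h) := Tree.measurableSpace S n Ca Cs h

/-- The average of `f` over the `Cs` sampled next states (with subtrees) of a branch. -/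
def Branch.avg {S : Type u} {n Ca Cs h : ℕ} (b : Branch S n Ca Cs h)
    (f : S → Tree S n Ca Cs h → ℝ) : ℝ :=
  (Cs : ℝ)⁻¹ * ∑ k, f (b.2 k).1 (b.2 k).2

/-- The VOSS value estimate `EstimateV` at state `s`, read off the tree. -/
def vHat {S : Type u} [MeasurableSpace S] {n : ℕ} (M : MDP S n) (Ca Cs : ℕ) :
    (h : ℕ) → S → Tree S n Ca Cs h → ℝ
  | 0, _, _ => 0
  | h + 1, s, t => ⨆ i : Fin Ca, M.R s (t i).1 + M.γ * Branch.avg (t i) (vHat M Ca Cs h)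

/-- The VOSS action value estimate `EstimateQ` of a branch at state `s`. -/
def qHat {S : Type u} [MeasurableSpace S] {n : ℕ} (M : MDP S n) (Ca Cs h : ℕ) (s : S)
    (b : Branch S n Ca Cs h) : ℝ :=
  M.R s b.1 + M.γ * Branch.avg b (vHat M Ca Cs h)

/-- The law of the first `k` branches at a node with state `s`, when subtrees at a state `s'` are
drawn from `sub s'`. The next action is a VOO action based on the earlier actions and their
VOSS estimates; then `Cs` independent next states with independent subtrees are drawn. -/
def nodeLaw {S : Type u} [MeasurableSpace S] {n : ℕ} (M : MDP S n)
    (δ : Action n → Action n → ℝ) (ω : ℝ) (Ca Cs h : ℕ)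
    (sub : S → Measure (Tree S n Ca Cs h)) (s : S) :
    (k : ℕ) → Measure (Fin k → Branch S n Ca Cs h)
  | 0 => Measure.dirac Fin.elim0
  | k + 1 =>
    (nodeLaw M δ ω Ca Cs h sub s k).bind fun b =>
      (vooLaw M.A δ ω (fun i => (b i).1) (fun i => qHat M Ca Cs h s (b i))).bind fun a =>
        (Measure.pi fun _ : Fin Cs => (M.T (s, a)).bind fun s' => (sub s').map (Prod.mk s')).map
          fun x => Fin.snoc (α := fun _ => Branch S n Ca Cs h) b (a, x)

/-- The law of the VOSS search tree with `h` steps to go, started in state `s`. -/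
def treeLaw {S : Type u} [MeasurableSpace S] {n : ℕ} (M : MDP S n)
    (δ : Action n → Action n → ℝ) (ω : ℝ) (Ca Cs : ℕ) :
    (h : ℕ) → S → Measure (Tree S n Ca Cs h)
  | 0, _ => Measure.dirac PUnit.unit
  | h + 1, s => nodeLaw M δ ω Ca Cs h (treeLaw M δ ω Ca Cs h) s Ca

/-- `𝔼 V̂^{Ca}(s)` with `h` steps to go, where `V̂^{Ca}(s)` is the maximum over the `Ca` VOO actions
`a` of `R(s,a) + γ 𝔼_{s' ∼ T(s,a)} V̂^{Ca}(s')`, the VOO step without state sampling. -/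
def vMean {S : Type u} [MeasurableSpace S] {n : ℕ} (M : MDP S n)
    (δ : Action n → Action n → ℝ) (ω : ℝ) (Ca Cs : ℕ) : ℕ → S → ℝ
  | 0, _ => 0
  | h + 1, s => ∫ t : Tree S n Ca Cs (h + 1),
      (⨆ i : Fin Ca, M.lookahead (vMean M δ ω Ca Cs h) s (t i).1) ∂(treeLaw M δ ω Ca Cs (h + 1) s)

/-- The intermediate random variable `V̂^{Ca}(s)`, read off the tree. -/
def vMid {S : Type u} [MeasurableSpace S] {n : ℕ} (M : MDP S n)
    (δ : Action n → Action n → ℝ) (ω : ℝ) (Ca Cs : ℕ) :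
    (h : ℕ) → S → Tree S n Ca Cs h → ℝ
  | 0, _, _ => 0
  | h + 1, s, t => ⨆ i : Fin Ca, M.lookahead (vMean M δ ω Ca Cs h) s (t i).1

/-- The maximum over all of `A` of the function that the VOO agent at `s` optimizes. -/
def vSup {S : Type u} [MeasurableSpace S] {n : ℕ} (M : MDP S n)
    (δ : Action n → Action n → ℝ) (ω : ℝ) (Ca Cs : ℕ) : ℕ → S → ℝ
  | 0, _ => 0
  | h + 1, s => ⨆ a : M.A, M.lookahead (vMean M δ ω Ca Cs h) s a

/-- At every depth and state, the expected regret of the VOO agent is at most `ρ`. -/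
def RegretBound {S : Type u} [MeasurableSpace S] {n : ℕ} (M : MDP S n) (D : ℕ)
    (δ : Action n → Action n → ℝ) (ω : ℝ) (Ca Cs : ℕ) (ρ : ℝ) : Prop :=
  ∀ d < D, ∀ s, ∫ t, (vSup M δ ω Ca Cs (D - d) s - vMid M δ ω Ca Cs (D - d) s t)
    ∂(treeLaw M δ ω Ca Cs (D - d) s) ≤ ρ

/-- At all nodes and actions of the tree, the sample average of the `V̂^{Ca}` of the next states
is within `ε` of its mean value. -/
def AllWithin {S : Type u} [MeasurableSpace S] {n : ℕ} (M : MDP S n)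
    (δ : Action n → Action n → ℝ) (ω : ℝ) (Ca Cs : ℕ) (ε : ℝ) :
    (h : ℕ) → S → Tree S n Ca Cs h → Prop
  | 0, _, _ => True
  | h + 1, s, t => ∀ i : Fin Ca,
      |Branch.avg (t i) (vMid M δ ω Ca Cs h) - ∫ s', vMean M δ ω Ca Cs h s' ∂(M.T (s, (t i).1))|
        ≤ ε ∧
      ∀ k : Fin Cs, AllWithin M δ ω Ca Cs ε h ((t i).2 k).1 ((t i).2 k).2

/-- For every starting depth and state, the sparse-sampling averages at all depths of the tree
are within `ε` of their mean values with probability at least `1 - p`. -/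
def Concentrated {S : Type u} [MeasurableSpace S] {n : ℕ} (M : MDP S n) (D : ℕ)
    (δ : Action n → Action n → ℝ) (ω : ℝ) (Ca Cs : ℕ) (ε p : ℝ) : Prop :=
  ∀ d < D, ∀ s,
    1 - p ≤ (treeLaw M δ ω Ca Cs (D - d) s).real {t | AllWithin M δ ω Ca Cs ε (D - d) s t}

/-- `η(d) ≥ γ η(d+1) + ρ` for `d < D`, and `η(D) = 0`. -/
def IsEta (γ : ℝ) (D : ℕ) (ρ : ℝ) (η : ℕ → ℝ) : Prop :=
  (∀ d < D, γ * η (d + 1) + ρ ≤ η d) ∧ η D = 0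

/-- `α(D-1) = ε + 2pVmax` and `α(d) = γ (α(d+1) + ε + 2pVmax)` for `d + 1 < D`. -/
def IsAlpha (γ Vmax : ℝ) (D : ℕ) (ε p : ℝ) (α : ℕ → ℝ) : Prop :=
  α (D - 1) = ε + 2 * p * Vmax ∧ ∀ d, d + 1 < D → α d = γ * (α (d + 1) + ε + 2 * p * Vmax)

/-- The maximum of a sequence over the depths `0, …, D - 1`. -/
def maxDepth (D : ℕ) (f : ℕ → ℝ) : ℝ := ⨆ d : Fin D, f d

end VOSS

end

/-! Write `Q^` for the lookahead of `vMean`. The intermediate value `vMid`, which is the best `Q^`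
among the drawn actions, separates two errors. A maximum over some actions cannot beat the optimum,
so `vMid ≤ vStar` almost surely, and `𝔼|vStar - vHat| ≤ (vStar - vMean) + 𝔼|vMid - vHat|`.

The bias `vStar - vMean` obeys a discounted recursion: replacing `vStar` by `vMean` inside the
lookahead costs `γ` times the error one level below, and VOO adds its regret. This gives `η`
(`vStar_le_vMean_add`). The sampling error is deterministic where all averages concentrate, since
each level adds at most `ε` before discounting (`abs_vMid_sub_vHat_le`). Elsewhere it is at most `2
* Vmax`, with probability at most `p`.

Concentration is Hoeffding plus a union bound. Although actions are chosen adaptively, the next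
states and subtrees of an action are i.i.d. once it is fixed, and one sample of `vMid` has mean `∫
vMean dT` (`integral_stateLaw_vMid`, `treeLaw_not_allWithin_le`).

The regret vanishes through exploration alone. Whatever the estimates are, each action is uniform on
`A` with probability at least `ω` (`le_vooLaw`), so a ball around a maximizer of `Q*` is missed by
all `Ca` actions with probability at most `κ ^ Ca`, where `κ < 1` depends only on the radius. Hence
the rate does not involve `Cs`. For the sampling term, a tolerance shrinking like the fourth root of
`(1 + log Ca + log Cs) / Cs` makes the Hoeffding exponent beat the logarithm of the number of
actions. -/

noncomputable section

namespace VOSS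

/-! ### Calculus of measurable families of probability measures. -/

/-- A measurable family of probability measures. -/
structure MarkovFamily {X Y : Type*} [MeasurableSpace X] [MeasurableSpace Y]
    (μ : X → Measure Y) : Prop where
  measurable : Measurable μ
  prob : ∀ x, IsProbabilityMeasure (μ x)

namespace MarkovFamily

variable {X Y Z : Type*} [MeasurableSpace X] [MeasurableSpace Y] [MeasurableSpace Z]

/-- The Markov kernel of a measurable family of probability measures. -/
def toKernel {μ : X → Measure Y} (hμ : MarkovFamily μ) : Kernel X Y := ⟨μ, hμ.measurable⟩

instance {μ : X → Measure Y} (hμ : MarkovFamily μ) : IsMarkovKernel hμ.toKernel :=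
  ⟨fun x => hμ.prob x⟩

theorem measurable_lintegral {μ : X → Measure Y} (hμ : MarkovFamily μ) {f : X → Y → ENNReal}
    (hf : Measurable (Function.uncurry f)) : Measurable fun x => ∫⁻ y, f x y ∂(μ x) :=
  Measurable.lintegral_kernel_prod_right' (κ := hμ.toKernel) hf

theorem measurable_integral {μ : X → Measure Y} (hμ : MarkovFamily μ) {f : X → Y → ℝ}
    (hf : Measurable (Function.uncurry f)) : Measurable fun x => ∫ y, f x y ∂(μ x) :=
  (StronglyMeasurable.integral_kernel_prod_right' (κ := hμ.toKernel)
    hf.stronglyMeasurable).measurable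

theorem measurable_measure {μ : X → Measure Y} (hμ : MarkovFamily μ) {s : Set (X × Y)}
    (hs : MeasurableSet s) : Measurable fun x => μ x {y | (x, y) ∈ s} :=
  Kernel.measurable_kernel_prodMk_left (κ := hμ.toKernel) hs

theorem const (μ : Measure Y) [h : IsProbabilityMeasure μ] :
    MarkovFamily fun _ : X => μ :=
  ⟨measurable_const, fun _ => h⟩

theorem comp {μ : Y → Measure Z} (hμ : MarkovFamily μ) {g : X → Y} (hg : Measurable g) :
    MarkovFamily fun x => μ (g x) :=
  ⟨hμ.measurable.comp hg, fun x => hμ.prob (g x)⟩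

theorem bind {μ : X → Measure Y} (hμ : MarkovFamily μ) {f : X → Y → Measure Z}
    (hf : MarkovFamily (Function.uncurry f)) : MarkovFamily fun x => (μ x).bind (f x) := by
  refine ⟨Measure.measurable_of_measurable_coe _ fun s hs => ?_, fun x => ?_⟩
  · have h : ∀ x, (μ x).bind (f x) s = ∫⁻ y, f x y s ∂(μ x) := fun x =>
      Measure.bind_apply hs (hf.measurable.of_uncurry_left).aemeasurable
    simp_rw [h]
    exact hμ.measurable_lintegral ((Measure.measurable_coe hs).comp hf.measurable)
  · have := hμ.prob x
    exact isProbabilityMeasure_bind (hf.measurable.of_uncurry_left).aemeasurable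
      (Eventually.of_forall fun y => hf.prob (x, y))

theorem map {μ : X → Measure Y} (hμ : MarkovFamily μ) {f : X → Y → Z}
    (hf : Measurable (Function.uncurry f)) : MarkovFamily fun x => (μ x).map (f x) := by
  refine ⟨Measure.measurable_of_measurable_coe _ fun s hs => ?_, fun x => ?_⟩
  · have h : ∀ x, (μ x).map (f x) s = μ x {y | (x, y) ∈ Function.uncurry f ⁻¹' s} := fun x =>
      Measure.map_apply hf.of_uncurry_left hs
    simp_rw [h]
    exact hμ.measurable_measure (hf hs)
  · have := hμ.prob x
    exact Measure.isProbabilityMeasure_map hf.of_uncurry_left.aemeasurable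

/-- Measurable rectangles form a generating π-system, and on them the product measure is a finite
product of measurable functions of the parameter. -/
theorem pi {m : ℕ} {μ : X → Measure Y} (hμ : MarkovFamily μ) :
    MarkovFamily fun x => Measure.pi fun _ : Fin m => μ x := by
  have := hμ.prob
  refine ⟨Measurable.measure_of_isPiSystem_of_isProbabilityMeasure generateFrom_pi.symm
    isPiSystem_pi ?_, fun x => inferInstance⟩
  rintro _ ⟨t, ht, rfl⟩
  simp_rw [Measure.pi_pi]
  exact Finset.measurable_prod _ fun i _ =>
    (Measure.measurable_coe (ht i (Set.mem_univ i))).comp hμ.measurable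

end MarkovFamily

theorem measurable_fin_snoc {Y : Type*} [MeasurableSpace Y] {k : ℕ} :
    Measurable fun p : (Fin k → Y) × Y => Fin.snoc (α := fun _ => Y) p.1 p.2 := by
  refine measurable_pi_iff.2 fun i => ?_
  refine Fin.lastCases ?_ (fun j => ?_) i
  · simpa using measurable_snd
  · simpa using measurable_fst.eval (a := j)

/-! ### The law of a single VOO action. -/

section Voo

variable {n : ℕ}

theorem exists_isBest {k : ℕ} (hk : k ≠ 0) (q : Fin k → ℝ) : ∃ i, IsBest q i := by
  classical
  have : Nonempty (Fin k) := ⟨⟨0, Nat.pos_of_ne_zero hk⟩⟩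
  have hne : (Finset.univ.filter fun i => ∀ j, q j ≤ q i).Nonempty := by
    obtain ⟨i, hi⟩ := Finite.exists_max q
    exact ⟨i, by simpa using hi⟩
  refine ⟨(Finset.univ.filter fun i => ∀ j, q j ≤ q i).min' hne, ?_, fun j hj => ?_⟩
  · simpa using Finset.min'_mem _ hne
  · by_contra! hle
    have hmax : ∀ l, q l ≤ q ((Finset.univ.filter fun i => ∀ j, q j ≤ q i).min' hne) := by
      simpa using Finset.min'_mem _ hne
    exact absurd (Finset.min'_le _ j (by simpa using fun l => (hmax l).trans hle)) (not_le.2 hj)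

theorem IsBest.unique {k : ℕ} {q : Fin k → ℝ} {i j : Fin k} (hi : IsBest q i)
    (hj : IsBest q j) : i = j := by
  rcases lt_trichotomy i j with h | h | h
  · exact absurd (hi.1 j) (not_le.2 (hj.2 i h))
  · exact h
  · exact absurd (hj.1 i) (not_le.2 (hi.2 j h))

theorem measurableSet_isBest {k : ℕ} (i : Fin k) : MeasurableSet {q : Fin k → ℝ | IsBest q i} := by
  have h : {q : Fin k → ℝ | IsBest q i} =
      (⋂ j, {q | q j ≤ q i}) ∩ ⋂ j, ⋂ (_ : j < i), {q | q j < q i} := by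
    ext q; simp [IsBest]
  rw [h]
  refine (MeasurableSet.iInter fun j => measurableSet_le (measurable_pi_apply j)
    (measurable_pi_apply i)).inter (MeasurableSet.iInter fun j => MeasurableSet.iInter fun _ =>
      measurableSet_lt (measurable_pi_apply j) (measurable_pi_apply i))

variable {A : Set (Action n)} {δ : Action n → Action n → ℝ} {ω : ℝ}

theorem measurableSet_voronoiCell_prod (hA : MeasurableSet A)
    (hδ : Measurable fun x : Action n × Action n => δ x.1 x.2) {k : ℕ} (i : Fin k) :
    MeasurableSet {p : (Fin k → Action n) × Action n | p.2 ∈ voronoiCell A δ p.1 i} := by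
  have h : {p : (Fin k → Action n) × Action n | p.2 ∈ voronoiCell A δ p.1 i} =
      Prod.snd ⁻¹' A ∩ ⋂ j, {p : (Fin k → Action n) × Action n |
        δ p.2 (p.1 i) ≤ δ p.2 (p.1 j)} := by
    ext p; simp [voronoiCell]
  have hm : ∀ j, Measurable fun p : (Fin k → Action n) × Action n => δ p.2 (p.1 j) := fun j =>
    hδ.comp (measurable_snd.prodMk ((measurable_pi_apply j).comp measurable_fst))
  rw [h]
  exact (measurable_snd hA).inter (MeasurableSet.iInter fun j => measurableSet_le (hm i) (hm j))

theorem measurableSet_voronoiCell (hA : MeasurableSet A)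
    (hδ : Measurable fun x : Action n × Action n => δ x.1 x.2) {k : ℕ} (c : Fin k → Action n)
    (i : Fin k) : MeasurableSet (voronoiCell A δ c i) :=
  measurable_prodMk_left (x := c) (measurableSet_voronoiCell_prod hA hδ i)

theorem voronoiCell_subset {k : ℕ} (c : Fin k → Action n) (i : Fin k) :
    voronoiCell A δ c i ⊆ A := fun _ h => h.1

theorem cond_isProbabilityMeasure_of_pos {B : Set (Action n)} (h0 : volume B ≠ 0)
    (h1 : volume B ≠ ⊤) : IsProbabilityMeasure (cond volume B) :=
  cond_isProbabilityMeasure_of_finite h0 h1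

theorem cellLaw_isProbabilityMeasure (h0 : 0 < volume A) (h1 : volume A < ⊤) {k : ℕ}
    (c : Fin k → Action n) (i : Fin k) : IsProbabilityMeasure (cellLaw A δ c i) := by
  unfold cellLaw
  split_ifs with h
  · exact cond_isProbabilityMeasure_of_pos h0.ne' h1.ne
  · exact cond_isProbabilityMeasure_of_pos h
      ((measure_mono (voronoiCell_subset c i)).trans_lt h1).ne

/-- Incidence of a point with a cell is jointly measurable in the centers and the point, so volumes
of cell sections are measurable in the centers. The fallback for null cells is then a measurable
case split. -/
theorem measurable_cellLaw (hA : MeasurableSet A)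
    (hδ : Measurable fun x : Action n × Action n => δ x.1 x.2) {k : ℕ} (i : Fin k) :
    Measurable fun c : Fin k → Action n => cellLaw A δ c i := by
  have hm : ∀ s, MeasurableSet s →
      Measurable fun c : Fin k → Action n => volume (voronoiCell A δ c i ∩ s) := fun s hs =>
    measurable_measure_prodMk_left
      ((measurableSet_voronoiCell_prod hA hδ i).inter (measurable_snd hs))
  have hv : Measurable fun c : Fin k → Action n => volume (voronoiCell A δ c i) := by
    simpa using hm _ MeasurableSet.univ
  refine Measure.measurable_of_measurable_coe _ fun s hs => ?_
  have h : ∀ c : Fin k → Action n, cellLaw A δ c i s =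
      if volume (voronoiCell A δ c i) = 0 then cond volume A s
      else (volume (voronoiCell A δ c i))⁻¹ * volume (voronoiCell A δ c i ∩ s) := fun c => by
    unfold cellLaw
    split_ifs
    · rfl
    · exact cond_apply (measurableSet_voronoiCell hA hδ c i) _ _
  simp_rw [h]
  exact Measurable.ite (hv (measurableSet_singleton 0)) measurable_const (hv.inv.mul (hm s hs))

theorem vooLaw_of_isBest {k : ℕ} {c : Fin k → Action n} {q : Fin k → ℝ} {i : Fin k}
    (hi : IsBest q i) : vooLaw A δ ω c q =
      ENNReal.ofReal ω • cond volume A + ENNReal.ofReal (1 - ω) • cellLaw A δ c i := by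
  have hk : k ≠ 0 := fun h => by subst h; exact i.elim0
  unfold vooLaw
  rw [if_neg hk, Finset.sum_eq_single i, if_pos hi]
  · exact fun j _ hj => if_neg fun h => hj (h.unique hi)
  · simp

theorem vooLaw_zero (c : Fin 0 → Action n) (q : Fin 0 → ℝ) :
    vooLaw A δ ω c q = cond volume A := by
  simp [vooLaw]

open scoped Classical in
theorem markovFamily_vooLaw (hA : MeasurableSet A) (h0 : 0 < volume A) (h1 : volume A < ⊤)
    (hδ : Measurable fun x : Action n × Action n => δ x.1 x.2) (hω : 0 < ω) (hω1 : ω ≤ 1)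
    (k : ℕ) :
    MarkovFamily fun p : (Fin k → Action n) × (Fin k → ℝ) => vooLaw A δ ω p.1 p.2 := by
  have := cond_isProbabilityMeasure_of_pos h0.ne' h1.ne
  constructor
  · rcases Nat.eq_zero_or_pos k with rfl | hk
    · simp_rw [vooLaw_zero]; exact measurable_const
    · refine Measure.measurable_of_measurable_coe _ fun s hs => ?_
      simp only [vooLaw, hk.ne', if_false, Measure.add_apply, Measure.smul_apply, smul_eq_mul,
        Measure.finsetSum_apply]
      refine measurable_const.add (measurable_const.mul (Finset.measurable_sum _ fun i _ => ?_))
      have h : ∀ p : (Fin k → Action n) × (Fin k → ℝ),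
          (if IsBest p.2 i then cellLaw A δ p.1 i else 0) s =
            if IsBest p.2 i then cellLaw A δ p.1 i s else 0 := fun p => by split_ifs <;> rfl
      simp_rw [h]
      exact Measurable.ite (measurable_snd (measurableSet_isBest i))
        ((Measure.measurable_coe hs).comp ((measurable_cellLaw hA hδ i).comp measurable_fst))
        measurable_const
  · rintro ⟨c, q⟩
    rcases Nat.eq_zero_or_pos k with rfl | hk
    · simp_rw [vooLaw_zero]; infer_instance
    · obtain ⟨i, hi⟩ := exists_isBest hk.ne' q
      have := cellLaw_isProbabilityMeasure (δ := δ) h0 h1 c i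
      refine ⟨?_⟩
      simp only [vooLaw_of_isBest hi, Measure.add_apply, Measure.smul_apply, smul_eq_mul,
        measure_univ, mul_one]
      rw [← ENNReal.ofReal_add hω.le (by linarith)]
      simp

theorem vooLaw_compl (hA : MeasurableSet A) {k : ℕ} (c : Fin k → Action n) (q : Fin k → ℝ)
    (hδ : Measurable fun x : Action n × Action n => δ x.1 x.2) :
    vooLaw A δ ω c q Aᶜ = 0 := by
  have h : ∀ B ⊆ A, MeasurableSet B → cond volume B Aᶜ = 0 := fun B hB hm => by
    rw [cond_apply hm, (Set.disjoint_compl_right_iff_subset.2 hB).inter_eq]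
    simp
  rcases Nat.eq_zero_or_pos k with rfl | hk
  · rw [vooLaw_zero]; exact h A le_rfl hA
  · obtain ⟨i, hi⟩ := exists_isBest hk.ne' q
    have hc : cellLaw A δ c i Aᶜ = 0 := by
      unfold cellLaw
      split_ifs
      · exact h A le_rfl hA
      · exact h _ (voronoiCell_subset c i) (measurableSet_voronoiCell hA hδ c i)
    simp [vooLaw_of_isBest hi, h A le_rfl hA, hc]

/-- The exploration part alone gives this minorization, uniformly in the history. The regret
analysis needs nothing about the Voronoi part beyond its being supported in `A`. -/
theorem le_vooLaw (hω1 : ω ≤ 1) {k : ℕ} (c : Fin k → Action n) (q : Fin k → ℝ)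
    (B : Set (Action n)) : ENNReal.ofReal ω * cond volume A B ≤ vooLaw A δ ω c q B := by
  rcases Nat.eq_zero_or_pos k with rfl | hk
  · rw [vooLaw_zero]
    exact mul_le_of_le_one_left' (by simpa using ENNReal.ofReal_le_ofReal hω1)
  · obtain ⟨i, hi⟩ := exists_isBest hk.ne' q
    simp [vooLaw_of_isBest hi]

end Voo

/-! ### Laws of branches, nodes and trees. -/

section Laws

variable {S : Type*} [MeasurableSpace S] {n : ℕ}

/-- The law of a next state together with its subtree. -/
def stateLaw (M : MDP S n) {Ca Cs h : ℕ} (sub : S → Measure (Tree S n Ca Cs h)) (s : S)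
    (a : Action n) : Measure (S × Tree S n Ca Cs h) :=
  (M.T (s, a)).bind fun s' => (sub s').map (Prod.mk s')

/-- The law of the branch of the action `a`. -/
def branchLaw (M : MDP S n) {Ca Cs h : ℕ} (sub : S → Measure (Tree S n Ca Cs h)) (s : S)
    (a : Action n) : Measure (Branch S n Ca Cs h) :=
  (Measure.pi fun _ : Fin Cs => stateLaw M sub s a).map (Prod.mk a)

variable {M : MDP S n} {Ca Cs h : ℕ} {Rmax : ℝ} {D : ℕ} {δ : Action n → Action n → ℝ} {ω L : ℝ}
  {sub : S → Measure (Tree S n Ca Cs h)}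

theorem markovFamily_stateLaw (hM : M.Regular Rmax) (hsub : MarkovFamily sub) :
    MarkovFamily fun p : S × Action n => stateLaw M sub p.1 p.2 := by
  have := hM.markov
  have hT : MarkovFamily fun p : S × Action n => M.T p :=
    ⟨M.T.measurable, fun p => inferInstance⟩
  have hs : MarkovFamily fun s' => (sub s').map (Prod.mk s') := hsub.map measurable_id
  exact hT.bind (f := fun _ s' => (sub s').map (Prod.mk s')) (hs.comp measurable_snd)

theorem markovFamily_branchLaw (hM : M.Regular Rmax) (hsub : MarkovFamily sub) :
    MarkovFamily fun p : S × Action n => branchLaw M sub p.1 p.2 := by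
  refine (markovFamily_stateLaw hM hsub).pi.map (f := fun p => Prod.mk p.2) ?_
  exact (measurable_snd.comp measurable_fst).prodMk measurable_snd

theorem measurable_vHat (hM : M.Regular Rmax) (Ca Cs : ℕ) : ∀ h,
    Measurable fun p : S × Tree S n Ca Cs h => vHat M Ca Cs h p.1 p.2
  | 0 => measurable_const
  | h + 1 => by
    have ih := measurable_vHat hM Ca Cs h
    have hq : Measurable fun p : S × Branch S n Ca Cs h =>
        M.R p.1 p.2.1 + M.γ * Branch.avg p.2 (vHat M Ca Cs h) := by
      refine (hM.measurable_R.comp (measurable_fst.prodMk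
        (measurable_fst.comp measurable_snd))).add (measurable_const.mul (measurable_const.mul
          (Finset.measurable_sum _ fun k _ => ih.comp ?_)))
      exact (measurable_pi_apply k).comp (measurable_snd.comp measurable_snd)
    show Measurable fun p : S × (Fin Ca → Branch S n Ca Cs h) =>
      ⨆ i : Fin Ca, M.R p.1 (p.2 i).1 + M.γ * Branch.avg (p.2 i) (vHat M Ca Cs h)
    refine Measurable.iSup fun i => ?_
    exact hq.comp (measurable_fst.prodMk ((measurable_pi_apply i).comp measurable_snd))

theorem measurable_avg {f : S → Tree S n Ca Cs h → ℝ}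
    (hf : Measurable fun p : S × Tree S n Ca Cs h => f p.1 p.2) :
    Measurable fun b : Branch S n Ca Cs h => Branch.avg b f :=
  measurable_const.mul (Finset.measurable_sum _ fun k _ =>
    hf.comp ((measurable_pi_apply k).comp measurable_snd))

theorem measurable_qHat (hM : M.Regular Rmax) (Ca Cs h : ℕ) :
    Measurable fun p : S × Branch S n Ca Cs h => qHat M Ca Cs h p.1 p.2 :=
  (hM.measurable_R.comp (measurable_fst.prodMk (measurable_fst.comp measurable_snd))).add
    (measurable_const.mul ((measurable_avg (measurable_vHat hM Ca Cs h)).comp measurable_snd))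

/-- The law of the next branch given the earlier ones. -/
def nextLaw (M : MDP S n) (δ : Action n → Action n → ℝ) (ω : ℝ) (Ca Cs h : ℕ) (s : S)
    {k : ℕ} (b : Fin k → Branch S n Ca Cs h) :
    Measure (Action n) :=
  vooLaw M.A δ ω (fun i => (b i).1) (fun i => qHat M Ca Cs h s (b i))

theorem markovFamily_nextLaw (hM : M.Regular Rmax) (hV : VOORegular M D δ ω L) (k : ℕ) :
    MarkovFamily fun p : S × (Fin k → Branch S n Ca Cs h) =>
      nextLaw M δ ω Ca Cs h p.1 p.2 := by
  refine (markovFamily_vooLaw hM.measurableSet_A hM.volume_pos hM.volume_lt_top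
    hV.measurable_dist hV.ω_pos hV.ω_le_one k).comp (g := fun p : S × (Fin k → Branch S n Ca Cs h)
      => ((fun i => (p.2 i).1), fun i => qHat M Ca Cs h p.1 (p.2 i))) ?_
  refine Measurable.prodMk (measurable_pi_iff.2 fun i => ?_) (measurable_pi_iff.2 fun i => ?_)
  · exact measurable_fst.comp ((measurable_pi_apply i).comp measurable_snd)
  · exact (measurable_qHat hM Ca Cs h).comp
      (measurable_fst.prodMk ((measurable_pi_apply i).comp measurable_snd))

theorem nodeLaw_succ (k : ℕ) (s : S) : nodeLaw M δ ω Ca Cs h sub s (k + 1) =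
    (nodeLaw M δ ω Ca Cs h sub s k).bind fun b => (nextLaw M δ ω Ca Cs h s b).bind fun a =>
      (Measure.pi fun _ : Fin Cs => stateLaw M sub s a).map
        fun x => Fin.snoc (α := fun _ => Branch S n Ca Cs h) b (a, x) := rfl

theorem markovFamily_step (hM : M.Regular Rmax) (hV : VOORegular M D δ ω L)
    (hsub : MarkovFamily sub) (k : ℕ) :
    MarkovFamily fun p : S × (Fin k → Branch S n Ca Cs h) =>
      (nextLaw M δ ω Ca Cs h p.1 p.2).bind fun a =>
        (Measure.pi fun _ : Fin Cs => stateLaw M sub p.1 a).map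
          fun x => Fin.snoc (α := fun _ => Branch S n Ca Cs h) p.2 (a, x) := by
  refine (markovFamily_nextLaw hM hV k).bind (f := fun p a =>
    (Measure.pi fun _ : Fin Cs => stateLaw M sub p.1 a).map
          fun x => Fin.snoc (α := fun _ => Branch S n Ca Cs h) p.2 (a, x)) ?_
  have h1 : MarkovFamily fun p : (S × (Fin k → Branch S n Ca Cs h)) × Action n =>
      Measure.pi fun _ : Fin Cs => stateLaw M sub p.1.1 p.2 :=
    (markovFamily_stateLaw hM hsub).pi.comp
      (g := fun p : (S × (Fin k → Branch S n Ca Cs h)) × Action n => (p.1.1, p.2))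
      ((measurable_fst.comp measurable_fst).prodMk measurable_snd)
  refine h1.map (f := fun p x => Fin.snoc (α := fun _ => Branch S n Ca Cs h) p.1.2 (p.2, x)) ?_
  exact measurable_fin_snoc.comp (((measurable_snd.comp measurable_fst).comp
    measurable_fst).prodMk ((measurable_snd.comp measurable_fst).prodMk measurable_snd))

theorem markovFamily_nodeLaw (hM : M.Regular Rmax) (hV : VOORegular M D δ ω L)
    (hsub : MarkovFamily sub) : ∀ k,
    MarkovFamily fun s : S => nodeLaw M δ ω Ca Cs h sub s k
  | 0 => MarkovFamily.const (Measure.dirac Fin.elim0)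
  | k + 1 => by
    simp_rw [nodeLaw_succ]
    exact (markovFamily_nodeLaw hM hV hsub k).bind (markovFamily_step hM hV hsub k)

theorem markovFamily_treeLaw (hM : M.Regular Rmax) (hV : VOORegular M D δ ω L) (Ca Cs : ℕ) :
    ∀ h, MarkovFamily fun s : S => treeLaw M δ ω Ca Cs h s
  | 0 => MarkovFamily.const (Measure.dirac PUnit.unit)
  | h + 1 => markovFamily_nodeLaw hM hV (markovFamily_treeLaw hM hV Ca Cs h) Ca

/-- One-step disintegration into history, next action and its branch: the form in which inductions
over the number of drawn branches are carried out. -/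
theorem nodeLaw_succ_apply (hM : M.Regular Rmax) (hV : VOORegular M D δ ω L)
    (hsub : MarkovFamily sub) (k : ℕ) (s : S) {E : Set (Fin (k + 1) → Branch S n Ca Cs h)}
    (hE : MeasurableSet E) : nodeLaw M δ ω Ca Cs h sub s (k + 1) E =
      ∫⁻ b, ∫⁻ a, branchLaw M sub s a
        {x | Fin.snoc (α := fun _ => Branch S n Ca Cs h) b x ∈ E}
        ∂(nextLaw M δ ω Ca Cs h s b) ∂(nodeLaw M δ ω Ca Cs h sub s k) := by
  have hs : ∀ b : Fin k → Branch S n Ca Cs h,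
      Measurable fun x => Fin.snoc (α := fun _ => Branch S n Ca Cs h) b x := fun b =>
    measurable_fin_snoc.comp measurable_prodMk_left
  rw [nodeLaw_succ]
  have h1 : ∀ b : Fin k → Branch S n Ca Cs h, Measurable fun a : Action n =>
      (Measure.pi fun _ : Fin Cs => stateLaw M sub s a).map
        fun x => Fin.snoc (α := fun _ => Branch S n Ca Cs h) b (a, x) := fun b =>
    (MarkovFamily.map (f := fun a x => Fin.snoc (α := fun _ => Branch S n Ca Cs h) b (a, x))
      ((markovFamily_stateLaw hM hsub).pi.comp (measurable_prodMk_left (x := s)))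
      (hs b)).measurable
  refine (Measure.bind_apply hE (((markovFamily_step hM hV hsub k).measurable.comp
    (measurable_prodMk_left (x := s))).aemeasurable)).trans (lintegral_congr fun b =>
      (Measure.bind_apply hE (h1 b).aemeasurable).trans (lintegral_congr fun a => ?_))
  exact (Measure.map_apply ((hs b).comp measurable_prodMk_left) hE).trans
    (Measure.map_apply measurable_prodMk_left ((hs b) hE)).symm

end Laws

/-! ### Bounds for finite maxima. -/

section Finite

variable {ι : Type*} [Finite ι]

/-- Nonnegativity of `C` covers the empty index type, where the real supremum is `0`. -/
theorem abs_iSup_le_of_finite {f : ι → ℝ} {C : ℝ} (hC : 0 ≤ C) (hf : ∀ i, |f i| ≤ C) :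
    |⨆ i, f i| ≤ C := by
  rcases isEmpty_or_nonempty ι with h | ⟨⟨i⟩⟩
  · simpa using hC
  · exact abs_le.2 ⟨(abs_le.1 (hf i)).1.trans (le_ciSup (Set.finite_range f).bddAbove i),
      Real.iSup_le (fun j => (abs_le.1 (hf j)).2) hC⟩

theorem abs_iSup_sub_iSup_le {f g : ι → ℝ} {C : ℝ} (hC : 0 ≤ C)
    (h : ∀ i, |f i - g i| ≤ C) : |(⨆ i, f i) - ⨆ i, g i| ≤ C := by
  rcases isEmpty_or_nonempty ι with h' | h'
  · simpa using hC
  · have key : ∀ f g : ι → ℝ, (∀ i, |f i - g i| ≤ C) → (⨆ i, f i) ≤ (⨆ i, g i) + C :=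
      fun f g h => ciSup_le fun i => by
        have := le_ciSup (Set.finite_range g).bddAbove i
        linarith [(abs_le.1 (h i)).2]
    rw [abs_sub_le_iff]
    constructor
    · linarith [key f g h]
    · linarith [key g f fun i => by rw [abs_sub_comm]; exact h i]

end Finite

/-! ### Union bounds and exploration at a single node. -/

section Laws

variable {S : Type*} [MeasurableSpace S] {n : ℕ} {M : MDP S n} {Ca Cs h : ℕ} {Rmax : ℝ} {D : ℕ}
  {δ : Action n → Action n → ℝ} {ω L : ℝ} {sub : S → Measure (Tree S n Ca Cs h)}

theorem stateLaw_apply (hsub : MarkovFamily sub) (s : S) (a : Action n)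
    {G : Set (S × Tree S n Ca Cs h)} (hG : MeasurableSet G) :
    stateLaw M sub s a G = ∫⁻ s', sub s' {t | (s', t) ∈ G} ∂(M.T (s, a)) := by
  have hs : MarkovFamily fun s' => (sub s').map (Prod.mk s') := hsub.map measurable_id
  refine (Measure.bind_apply hG hs.measurable.aemeasurable).trans (lintegral_congr fun s' => ?_)
  exact Measure.map_apply measurable_prodMk_left hG

theorem stateLaw_le (hM : M.Regular Rmax) (hsub : MarkovFamily sub) (s : S) (a : Action n)
    {G : Set (S × Tree S n Ca Cs h)} (hG : MeasurableSet G) {θ : ENNReal}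
    (hθ : ∀ s', sub s' {t | (s', t) ∈ G} ≤ θ) : stateLaw M sub s a G ≤ θ := by
  have := hM.markov
  rw [stateLaw_apply hsub s a hG]
  exact (lintegral_mono hθ).trans (by simp)

/-- The law is a composition product of the transition law with the subtree kernel, so Fubini
applies. -/
theorem integral_stateLaw (hM : M.Regular Rmax) (hsub : MarkovFamily sub) (s : S) (a : Action n)
    {f : S × Tree S n Ca Cs h → ℝ} (hf : Integrable f (stateLaw M sub s a)) :
    ∫ x, f x ∂(stateLaw M sub s a) = ∫ s', ∫ t, f (s', t) ∂(sub s') ∂(M.T (s, a)) := by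
  have := hM.markov
  have h : stateLaw M sub s a = M.T (s, a) ⊗ₘ hsub.toKernel := by
    ext G hG
    rw [stateLaw_apply hsub s a hG, Measure.compProd_apply hG]
    rfl
  rw [h] at hf ⊢
  exact Measure.integral_compProd hf

theorem branchLaw_apply (s : S) (a : Action n) {E : Set (Branch S n Ca Cs h)}
    (hE : MeasurableSet E) : branchLaw M sub s a E =
      Measure.pi (fun _ : Fin Cs => stateLaw M sub s a) {y | (a, y) ∈ E} :=
  Measure.map_apply measurable_prodMk_left hE

theorem pi_exists_le {Y : Type*} [MeasurableSpace Y] (μ : Measure Y) [IsProbabilityMeasure μ]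
    {m : ℕ} {G : Set Y} (hG : MeasurableSet G) :
    Measure.pi (fun _ : Fin m => μ) {y | ∃ k, y k ∈ G} ≤ m * μ G := by
  have h : {y : Fin m → Y | ∃ k, y k ∈ G} = ⋃ k, Function.eval k ⁻¹' G := by ext; simp
  rw [h]
  refine (measure_iUnion_fintype_le _ _).trans ?_
  simp [fun k => (measurePreserving_eval (fun _ : Fin m => μ) k).measure_preimage
    hG.nullMeasurableSet]

theorem ae_mem_nextLaw (hM : M.Regular Rmax) (hV : VOORegular M D δ ω L) (s : S) {k : ℕ}
    (b : Fin k → Branch S n Ca Cs h) : ∀ᵐ a ∂(nextLaw M δ ω Ca Cs h s b), a ∈ M.A :=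
  vooLaw_compl hM.measurableSet_A _ _ hV.measurable_dist

theorem measurableSet_exists_branch {k : ℕ} {B : Set (Branch S n Ca Cs h)}
    (hB : MeasurableSet B) :
    MeasurableSet {b : Fin k → Branch S n Ca Cs h | ∃ i, b i ∈ B} := by
  have h : {b : Fin k → Branch S n Ca Cs h | ∃ i, b i ∈ B} = ⋃ i, Function.eval i ⁻¹' B := by
    ext; simp
  rw [h]
  exact MeasurableSet.iUnion fun i => measurable_pi_apply i hB

/-- Union bound over the branches of a node. -/
theorem nodeLaw_exists_le (hM : M.Regular Rmax) (hV : VOORegular M D δ ω L)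
    (hsub : MarkovFamily sub) (s : S) {B : Set (Branch S n Ca Cs h)} (hB : MeasurableSet B)
    {θ : ENNReal} (hθ : ∀ a ∈ M.A, branchLaw M sub s a B ≤ θ) : ∀ k : ℕ,
    nodeLaw M δ ω Ca Cs h sub s k {b | ∃ i, b i ∈ B} ≤ k * θ
  | 0 => by simp
  | k + 1 => by
    have ih := nodeLaw_exists_le hM hV hsub s hB hθ k
    have hk := measurableSet_exists_branch (k := k) hB
    have hp := (markovFamily_nodeLaw (Ca := Ca) (Cs := Cs) hM hV hsub k).prob s
    rw [nodeLaw_succ_apply hM hV hsub k s (measurableSet_exists_branch hB)]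
    -- Either an earlier branch is already in `B`, paid for by the indicator, or the new one must
    -- be, paid for by `θ`.
    have hb : ∀ b : Fin k → Branch S n Ca Cs h,
        ∫⁻ a, branchLaw M sub s a {x | Fin.snoc (α := fun _ => Branch S n Ca Cs h) b x ∈
          {b : Fin (k + 1) → Branch S n Ca Cs h | ∃ i, b i ∈ B}} ∂(nextLaw M δ ω Ca Cs h s b)
          ≤ {b : Fin k → Branch S n Ca Cs h | ∃ i, b i ∈ B}.indicator 1 b + θ := fun b => by
      have hp' := (markovFamily_nextLaw (Ca := Ca) (Cs := Cs) (h := h) hM hV k).prob (s, b)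
      refine (lintegral_mono_ae (g := fun _ =>
        {b : Fin k → Branch S n Ca Cs h | ∃ i, b i ∈ B}.indicator 1 b + θ) ?_).trans ?_
      · filter_upwards [ae_mem_nextLaw hM hV s b] with a ha
        have hp'' := (markovFamily_branchLaw hM hsub).prob (s, a)
        by_cases hbk : ∃ i, b i ∈ B
        · rw [Set.indicator_of_mem (by exact hbk)]
          exact prob_le_one.trans le_self_add
        · rw [Set.indicator_of_notMem (by exact hbk), zero_add]
          refine (measure_mono fun x hx => ?_).trans (hθ a ha)
          simpa [Fin.exists_fin_succ', hbk] using hx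
      · simp [hp'.measure_univ]
    refine (lintegral_mono hb).trans ?_
    rw [lintegral_add_right _ measurable_const, lintegral_indicator_one hk]
    simp only [lintegral_const, measure_univ, mul_one]
    push_cast
    rw [add_mul, one_mul]
    gcongr

theorem measurableSet_forall_notMem {k : ℕ} {U : Set (Action n)} (hU : MeasurableSet U) :
    MeasurableSet {b : Fin k → Branch S n Ca Cs h | ∀ i, (b i).1 ∉ U} := by
  have h : {b : Fin k → Branch S n Ca Cs h | ∀ i, (b i).1 ∉ U} =
    ⋂ i, (fun b => (b i).1) ⁻¹' Uᶜ := by ext; simp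
  rw [h]
  exact MeasurableSet.iInter fun i => (measurable_fst.comp (measurable_pi_apply i)) hU.compl

/-- Since every action is uniform with probability `ω`, a set is missed by all the actions of a
node with exponentially small probability. -/
theorem nodeLaw_forall_notMem_le (hM : M.Regular Rmax) (hV : VOORegular M D δ ω L)
    (hsub : MarkovFamily sub) (s : S) {U : Set (Action n)} (hU : MeasurableSet U) : ∀ k : ℕ,
    nodeLaw M δ ω Ca Cs h sub s k {b | ∀ i, (b i).1 ∉ U} ≤
      (1 - ENNReal.ofReal ω * cond volume M.A U) ^ k
  | 0 => by
    have := (markovFamily_nodeLaw (Ca := Ca) (Cs := Cs) hM hV hsub 0).prob s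
    simp
  | k + 1 => by
    have ih := nodeLaw_forall_notMem_le hM hV hsub s hU k
    have hm : ∀ k, MeasurableSet {b : Fin k → Branch S n Ca Cs h | ∀ i, (b i).1 ∉ U} := fun k =>
      measurableSet_forall_notMem hU
    rw [nodeLaw_succ_apply hM hV hsub k s (hm _)]
    -- The history contributes only through the indicator that `U` is still unvisited. Given this,
    -- the new action misses `U` with at most the stated probability, so each step multiplies the
    -- bound by one factor.
    have hb : ∀ b : Fin k → Branch S n Ca Cs h,
        ∫⁻ a, branchLaw M sub s a {x | Fin.snoc (α := fun _ => Branch S n Ca Cs h) b x ∈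
          {b : Fin (k + 1) → Branch S n Ca Cs h | ∀ i, (b i).1 ∉ U}} ∂(nextLaw M δ ω Ca Cs h s b)
          ≤ {b : Fin k → Branch S n Ca Cs h | ∀ i, (b i).1 ∉ U}.indicator
            (fun _ => 1 - ENNReal.ofReal ω * cond volume M.A U) b := fun b => by
      have hp' := (markovFamily_nextLaw (Ca := Ca) (Cs := Cs) (h := h) hM hV k).prob (s, b)
      have hset : ∀ a, branchLaw M sub s a
          {x | Fin.snoc (α := fun _ => Branch S n Ca Cs h) b x ∈
            {b : Fin (k + 1) → Branch S n Ca Cs h | ∀ i, (b i).1 ∉ U}} ≤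
          {b : Fin k → Branch S n Ca Cs h | ∀ i, (b i).1 ∉ U}.indicator
            (fun _ => Uᶜ.indicator 1 a) b := fun a => by
        have hp'' := (markovFamily_branchLaw hM hsub).prob (s, a)
        have hms : Measurable fun x => Fin.snoc (α := fun _ => Branch S n Ca Cs h) b x :=
          measurable_fin_snoc.comp measurable_prodMk_left
        refine (branchLaw_apply s a (hms (hm _))).trans_le ?_
        have hq := ((markovFamily_stateLaw hM hsub).pi (m := Cs)).prob (s, a)
        by_cases hbk : ∀ i, (b i).1 ∉ U
        · rw [Set.indicator_of_mem (by exact hbk)]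
          by_cases ha : a ∈ U
          · simp [Fin.forall_fin_succ', ha]
          · rw [Set.indicator_of_mem (by exact ha)]
            exact prob_le_one
        · simp [Fin.forall_fin_succ', hbk]
      refine (lintegral_mono hset).trans ?_
      by_cases hbk : ∀ i, (b i).1 ∉ U
      · simp only [Set.indicator_of_mem (show b ∈ {b : Fin k → Branch S n Ca Cs h |
          ∀ i, (b i).1 ∉ U} from hbk)]
        rw [lintegral_indicator_one hU.compl, prob_compl_eq_one_sub hU]
        exact tsub_le_tsub_left (le_vooLaw hV.ω_le_one _ _ U) 1
      · simp [Set.indicator_of_notMem (show b ∉ {b : Fin k → Branch S n Ca Cs h |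
          ∀ i, (b i).1 ∉ U} from hbk)]
    refine (lintegral_mono hb).trans ?_
    rw [lintegral_indicator_const (hm k), pow_succ, mul_comm]
    gcongr

end Laws

/-! ### Measurability of the values read off the tree and of the concentration event. -/

section Measurability

variable {S : Type*} [MeasurableSpace S] {n : ℕ} {M : MDP S n} {Rmax : ℝ} {D : ℕ}
  {δ : Action n → Action n → ℝ} {ω L : ℝ}

theorem measurable_lookahead (hM : M.Regular Rmax) {v : S → ℝ} (hv : Measurable v) :
    Measurable fun p : S × Action n => M.lookahead v p.1 p.2 := by
  have := hM.markov
  have hT : MarkovFamily fun p : S × Action n => M.T p :=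
    ⟨M.T.measurable, fun p => inferInstance⟩
  exact hM.measurable_R.add (measurable_const.mul
    (hT.measurable_integral (f := fun _ s' => v s') (hv.comp measurable_snd)))

/-- Measurability of `vMean` is a hypothesis here to untangle the mutual dependence: `vMid` at level
`h + 1` uses only `vMean` at level `h`, and `vMean` at level `h + 1` is its integral. -/
theorem measurable_vMid_succ (hM : M.Regular Rmax) {Ca Cs h : ℕ}
    (hv : Measurable (vMean M δ ω Ca Cs h)) :
    Measurable fun p : S × Tree S n Ca Cs (h + 1) => vMid M δ ω Ca Cs (h + 1) p.1 p.2 := by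
  show Measurable fun p : S × (Fin Ca → Branch S n Ca Cs h) =>
    ⨆ i : Fin Ca, M.lookahead (vMean M δ ω Ca Cs h) p.1 (p.2 i).1
  refine Measurable.iSup fun i => ?_
  exact (measurable_lookahead hM hv).comp (measurable_fst.prodMk
    (measurable_fst.comp ((measurable_pi_apply i).comp measurable_snd)))

theorem vMean_eq_integral_vMid (Ca Cs : ℕ) (h : ℕ) (s : S) : vMean M δ ω Ca Cs h s =
    ∫ t, vMid M δ ω Ca Cs h s t ∂(treeLaw M δ ω Ca Cs h s) := by
  cases h with
  | zero => simp [vMean, vMid]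
  | succ h => rfl

theorem measurable_vMean (hM : M.Regular Rmax) (hV : VOORegular M D δ ω L) (Ca Cs : ℕ) : ∀ h,
    Measurable (vMean M δ ω Ca Cs h)
  | 0 => measurable_const
  | h + 1 => (markovFamily_treeLaw hM hV Ca Cs (h + 1)).measurable_integral
      (f := fun s t => vMid M δ ω Ca Cs (h + 1) s t)
      (measurable_vMid_succ hM (measurable_vMean hM hV Ca Cs h))

theorem measurable_vMid (hM : M.Regular Rmax) (hV : VOORegular M D δ ω L) (Ca Cs : ℕ) : ∀ h,
    Measurable fun p : S × Tree S n Ca Cs h => vMid M δ ω Ca Cs h p.1 p.2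
  | 0 => measurable_const
  | h + 1 => measurable_vMid_succ hM (measurable_vMean hM hV Ca Cs h)

/-- The branches at which sampling fails, at the root or further below. -/
def badBranch (M : MDP S n) (δ : Action n → Action n → ℝ) (ω : ℝ) (Ca Cs : ℕ) (ε : ℝ) (h : ℕ)
    (s : S) : Set (Branch S n Ca Cs h) :=
  {b | ¬ (|Branch.avg b (vMid M δ ω Ca Cs h) - ∫ s', vMean M δ ω Ca Cs h s' ∂(M.T (s, b.1))| ≤ ε ∧
    ∀ k, AllWithin M δ ω Ca Cs ε h (b.2 k).1 (b.2 k).2)}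

theorem allWithin_succ_iff (Ca Cs : ℕ) (ε : ℝ) (h : ℕ) (s : S)
    (t : Fin Ca → Branch S n Ca Cs h) :
    AllWithin M δ ω Ca Cs ε (h + 1) s t ↔ ¬ ∃ i, t i ∈ badBranch M δ ω Ca Cs ε h s := by
  simp only [badBranch, Set.mem_ofPred_eq, not_exists, not_not]
  rfl

theorem measurableSet_badBranch_prod (hM : M.Regular Rmax) (hV : VOORegular M D δ ω L)
    {Ca Cs : ℕ} {ε : ℝ} {h : ℕ}
    (ih : MeasurableSet {p : S × Tree S n Ca Cs h | AllWithin M δ ω Ca Cs ε h p.1 p.2}) :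
    MeasurableSet {p : S × Branch S n Ca Cs h | p.2 ∈ badBranch M δ ω Ca Cs ε h p.1} := by
  have := hM.markov
  have hT : MarkovFamily fun p : S × Action n => M.T p :=
    ⟨M.T.measurable, fun p => inferInstance⟩
  have h1 : Measurable fun p : S × Branch S n Ca Cs h =>
      |Branch.avg p.2 (vMid M δ ω Ca Cs h) - ∫ s', vMean M δ ω Ca Cs h s' ∂(M.T (p.1, p.2.1))| := by
    refine Measurable.abs (((measurable_avg (measurable_vMid hM hV Ca Cs h)).comp
      measurable_snd).sub ?_)
    exact (hT.measurable_integral (f := fun _ s' => vMean M δ ω Ca Cs h s')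
      ((measurable_vMean hM hV Ca Cs h).comp measurable_snd)).comp
      (measurable_fst.prodMk (measurable_fst.comp measurable_snd))
  refine MeasurableSet.compl ((measurableSet_le h1 measurable_const).inter ?_)
  show MeasurableSet {p : S × Branch S n Ca Cs h |
    ∀ k, AllWithin M δ ω Ca Cs ε h (p.2.2 k).1 (p.2.2 k).2}
  rw [Set.ofPred_forall]
  refine MeasurableSet.iInter fun k => ?_
  have hk : Measurable fun p : S × Branch S n Ca Cs h => p.2.2 k :=
    (measurable_pi_apply k).comp (measurable_snd.comp measurable_snd)
  exact hk ih

theorem measurableSet_allWithin (hM : M.Regular Rmax) (hV : VOORegular M D δ ω L) (Ca Cs : ℕ)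
    (ε : ℝ) : ∀ h,
    MeasurableSet {p : S × Tree S n Ca Cs h | AllWithin M δ ω Ca Cs ε h p.1 p.2}
  | 0 => MeasurableSet.univ
  | h + 1 => by
    have hb := measurableSet_badBranch_prod hM hV (measurableSet_allWithin hM hV Ca Cs ε h)
    have h1 : {p : S × (Fin Ca → Branch S n Ca Cs h) | AllWithin M δ ω Ca Cs ε (h + 1) p.1 p.2} =
        ⋂ i, {p | (p.1, p.2 i) ∈
          {p : S × Branch S n Ca Cs h | p.2 ∈ badBranch M δ ω Ca Cs ε h p.1}}ᶜ := by
      ext p; simp [allWithin_succ_iff]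
    show MeasurableSet {p : S × (Fin Ca → Branch S n Ca Cs h) |
      AllWithin M δ ω Ca Cs ε (h + 1) p.1 p.2}
    rw [h1]
    exact MeasurableSet.iInter fun i => MeasurableSet.compl
      ((measurable_fst.prodMk ((measurable_pi_apply i).comp measurable_snd)) hb)

end Measurability

/-! ### Hoeffding's inequality for one sample average. -/

section Hoeffding

/-- Hoeffding's inequality for the average of `m` independent samples of a bounded function. -/
theorem pi_avg_deviation_le {Y : Type*} [MeasurableSpace Y] (μ : Measure Y)
    [IsProbabilityMeasure μ] {m : ℕ} (hm : 1 ≤ m) {f : Y → ℝ} (hf : Measurable f) {V : ℝ}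
    (hV : ∀ᵐ y ∂μ, |f y| ≤ V) {ε : ℝ} (hε : 0 ≤ ε) :
    (Measure.pi fun _ : Fin m => μ) {y | ε < |(m : ℝ)⁻¹ * ∑ k, f (y k) - ∫ y, f y ∂μ|} ≤
      ENNReal.ofReal (2 * Real.exp (-(2 * ε ^ 2 * m / (2 * V) ^ 2))) := by
  set P : Measure (Fin m → Y) := Measure.pi fun _ : Fin m => μ
  have hm0 : (0 : ℝ) < m := by exact_mod_cast hm
  have hmp : ∀ k, MeasurePreserving (fun y : Fin m → Y => y k) P μ := fun k =>
    measurePreserving_eval (fun _ : Fin m => μ) k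
  let X : Fin m → (Fin m → Y) → ℝ := fun k y => f (y k) - ∫ y, f y ∂μ
  have hind : iIndepFun X P :=
    iIndepFun_pi (μ := fun _ : Fin m => μ) (X := fun _ y => f y - ∫ y, f y ∂μ)
      fun k => (hf.sub_const _).aemeasurable
  -- Hoeffding's lemma on `[-V, V]`: half the width of the interval, squared, is the variance proxy.
  have hsub : ∀ k, HasSubgaussianMGF (X k) ((‖V - -V‖₊ / 2) ^ 2) P := fun k => by
    have hint : ∫ y, f (y k) ∂P = ∫ y, f y ∂μ := by
      rw [← (hmp k).map_eq,
        integral_map (hmp k).measurable.aemeasurable hf.aestronglyMeasurable]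
    have h := hasSubgaussianMGF_of_mem_Icc (μ := P) (X := fun y => f (y k)) (a := -V) (b := V)
      (hf.comp (hmp k).measurable).aemeasurable
      ((hmp k).quasiMeasurePreserving.ae (hV.mono fun y hy => abs_le.1 hy))
    rwa [hint] at h
  have hsum : ∀ y, (m : ℝ)⁻¹ * ∑ k, f (y k) - ∫ y, f y ∂μ = (m : ℝ)⁻¹ * ∑ k, X k y := fun y => by
    simp only [X, Finset.sum_sub_distrib, Finset.sum_const, Finset.card_univ, Fintype.card_fin,
      nsmul_eq_mul]
    field_simp
  have hexp : -(m * ε) ^ 2 / (2 * ((∑ _k : Fin m, (‖V - -V‖₊ / 2) ^ 2 : NNReal) : ℝ)) =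
      -(2 * ε ^ 2 * m / (2 * V) ^ 2) := by
    have hc : ((∑ _k : Fin m, (‖V - -V‖₊ / 2) ^ 2 : NNReal) : ℝ) = m * V ^ 2 := by
      simp only [Finset.sum_const, Finset.card_univ, Fintype.card_fin, nsmul_eq_mul]
      push_cast
      rw [Real.norm_eq_abs, div_pow, sq_abs]
      ring
    rw [hc]
    -- For `V = 0` both exponents are quotients by zero, hence `0`, and the final bound is the
    -- trivial value `2`.
    rcases eq_or_ne V 0 with rfl | hV0
    · simp
    · field_simp
  have hmε : 0 ≤ m * ε := mul_nonneg hm0.le hε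
  have h1 : P.real {y | m * ε ≤ ∑ k, X k y} ≤ Real.exp (-(2 * ε ^ 2 * m / (2 * V) ^ 2)) := by
    rw [← hexp]
    exact HasSubgaussianMGF.measure_sum_ge_le_of_iIndepFun hind (fun k _ => hsub k) hmε
  have h2 : P.real {y | m * ε ≤ ∑ k, -X k y} ≤ Real.exp (-(2 * ε ^ 2 * m / (2 * V) ^ 2)) := by
    rw [← hexp]
    exact HasSubgaussianMGF.measure_sum_ge_le_of_iIndepFun
      (hind.comp (fun _ x => -x) fun _ => measurable_neg) (fun k _ => (hsub k).neg) hmε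
  have hset : {y | ε < |(m : ℝ)⁻¹ * ∑ k, f (y k) - ∫ y, f y ∂μ|} ⊆
      {y | m * ε ≤ ∑ k, X k y} ∪ {y | m * ε ≤ ∑ k, -X k y} := by
    intro y hy
    have hy' : ε < (m : ℝ)⁻¹ * |∑ k, X k y| := by
      have h : ε < |(m : ℝ)⁻¹ * ∑ k, f (y k) - ∫ y, f y ∂μ| := hy
      rwa [hsum, abs_mul, abs_of_pos (inv_pos.2 hm0)] at h
    have hy2 : m * ε < |∑ k, X k y| := by
      rw [inv_mul_eq_div, lt_div_iff₀ hm0] at hy'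
      linarith
    rcases lt_abs.1 hy2 with h | h
    · exact Or.inl h.le
    · exact Or.inr (by simpa [Finset.sum_neg_distrib] using h.le)
  rw [ENNReal.le_ofReal_iff_toReal_le (measure_ne_top _ _) (by positivity)]
  calc P.real {y | ε < |(m : ℝ)⁻¹ * ∑ k, f (y k) - ∫ y, f y ∂μ|}
      ≤ P.real ({y | m * ε ≤ ∑ k, X k y} ∪ {y | m * ε ≤ ∑ k, -X k y}) := measureReal_mono hset
    _ ≤ _ := measureReal_union_le _ _
    _ ≤ _ := by linarith

end Hoeffding

variable {S : Type*} [MeasurableSpace S] {n : ℕ} {M : MDP S n} {Rmax : ℝ} {D : ℕ}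
  {δ : Action n → Action n → ℝ} {ω L : ℝ}

/-! ### Almost sure bounds by `Vmax`. -/

section Bounds

theorem MDP.Regular.nonempty (hM : M.Regular Rmax) : M.A.Nonempty :=
  nonempty_of_measure_ne_zero hM.volume_pos.ne'

/-- A state is required: on an empty state space the reward bound is vacuous and `Rmax` may be
negative. -/
theorem MDP.Regular.Vmax_nonneg (hM : M.Regular Rmax) (s : S) : 0 ≤ M.Vmax Rmax := by
  obtain ⟨a, ha⟩ := hM.nonempty
  exact div_nonneg ((abs_nonneg _).trans (hM.bounded_R s a ha)) (by linarith [hM.γ_lt_one])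

/-- `Vmax` is the fixed point of `x ↦ Rmax + γ x`, so the bound `Vmax` survives every lookahead
step. -/
theorem MDP.Regular.Vmax_eq (hM : M.Regular Rmax) :
    Rmax + M.γ * M.Vmax Rmax = M.Vmax Rmax := by
  have : 1 - M.γ ≠ 0 := by linarith [hM.γ_lt_one]
  unfold MDP.Vmax
  field_simp
  ring

theorem MDP.Regular.abs_reward_add_le (hM : M.Regular Rmax) {s : S} {a : Action n} (ha : a ∈ M.A) {x : ℝ}
    (hx : |x| ≤ M.Vmax Rmax) : |M.R s a + M.γ * x| ≤ M.Vmax Rmax :=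
  calc |M.R s a + M.γ * x| ≤ |M.R s a| + |M.γ * x| := _root_.abs_add_le _ _
    _ ≤ Rmax + M.γ * M.Vmax Rmax := by
      rw [abs_mul, abs_of_nonneg hM.γ_nonneg]
      exact add_le_add (hM.bounded_R s a ha) (mul_le_mul_of_nonneg_left hx hM.γ_nonneg)
    _ = _ := hM.Vmax_eq

theorem abs_integral_le_of_abs_le {X : Type*} [MeasurableSpace X] {μ : Measure X}
    [IsProbabilityMeasure μ] {f : X → ℝ} {C : ℝ} (hf : ∀ᵐ x ∂μ, |f x| ≤ C) :
    |∫ x, f x ∂μ| ≤ C := by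
  simpa using norm_integral_le_of_norm_le_const (μ := μ) (f := f) hf

theorem abs_lookahead_le (hM : M.Regular Rmax) {v : S → ℝ} (hv : ∀ s, |v s| ≤ M.Vmax Rmax) (s : S)
    {a : Action n} (ha : a ∈ M.A) : |M.lookahead v s a| ≤ M.Vmax Rmax := by
  have := hM.markov
  exact hM.abs_reward_add_le ha (abs_integral_le_of_abs_le (Eventually.of_forall hv))

/-- All actions of the tree belong to `A`. -/
def ActionsIn (A : Set (Action n)) {Ca Cs : ℕ} : (h : ℕ) → Tree S n Ca Cs h → Prop
  | 0, _ => True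
  | h + 1, t => ∀ i : Fin Ca, (t i).1 ∈ A ∧ ∀ k : Fin Cs, ActionsIn A h ((t i).2 k).2

omit [MeasurableSpace S] in
theorem actionsIn_succ_iff {A : Set (Action n)} {Ca Cs h : ℕ} (t : Fin Ca → Branch S n Ca Cs h) :
    ActionsIn A (h + 1) t ↔ ∀ i, (t i).1 ∈ A ∧ ∀ k, ActionsIn A h ((t i).2 k).2 := Iff.rfl

theorem measurableSet_actionsIn_branch {A : Set (Action n)} (hA : MeasurableSet A) {Ca Cs h : ℕ}
    (ih : MeasurableSet {t : Tree S n Ca Cs h | ActionsIn A h t}) :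
    MeasurableSet {b : Branch S n Ca Cs h | b.1 ∈ A ∧ ∀ k, ActionsIn A h (b.2 k).2} := by
  refine (measurable_fst hA).inter ?_
  show MeasurableSet {b : Branch S n Ca Cs h | ∀ k, ActionsIn A h (b.2 k).2}
  rw [Set.ofPred_forall]
  refine MeasurableSet.iInter fun k => ?_
  have hk : Measurable fun b : Branch S n Ca Cs h => (b.2 k).2 :=
    measurable_snd.comp ((measurable_pi_apply k).comp measurable_snd)
  exact hk ih

theorem measurableSet_actionsIn {A : Set (Action n)} (hA : MeasurableSet A) (Ca Cs : ℕ) : ∀ h,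
    MeasurableSet {t : Tree S n Ca Cs h | ActionsIn A h t}
  | 0 => MeasurableSet.univ
  | h + 1 => by
    have hb := measurableSet_actionsIn_branch hA (measurableSet_actionsIn hA Ca Cs h)
    show MeasurableSet {t : Fin Ca → Branch S n Ca Cs h | ActionsIn A (h + 1) t}
    simp only [actionsIn_succ_iff]
    rw [Set.ofPred_forall]
    refine MeasurableSet.iInter fun i => ?_
    have hi : Measurable fun t : Fin Ca → Branch S n Ca Cs h => t i := measurable_pi_apply i
    exact hi hb

theorem branchLaw_exists_le (hM : M.Regular Rmax) {Ca Cs h : ℕ}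
    {sub : S → Measure (Tree S n Ca Cs h)} (hsub : MarkovFamily sub) (s : S) (a : Action n)
    {G : Set (S × Tree S n Ca Cs h)} (hG : MeasurableSet G) {θ : ENNReal}
    (hθ : ∀ s', sub s' {t | (s', t) ∈ G} ≤ θ) :
    Measure.pi (fun _ : Fin Cs => stateLaw M sub s a) {y | ∃ k, y k ∈ G} ≤ Cs * θ := by
  have := (markovFamily_stateLaw hM hsub).prob (s, a)
  refine (pi_exists_le _ hG).trans ?_
  gcongr
  exact stateLaw_le hM hsub s a hG hθ

/-- Rewards are bounded on `A` only, so bounds on tree values hold only almost surely, through this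
fact. It is the union bound over actions and samples with failure probability `0`. -/
theorem ae_actionsIn (hM : M.Regular Rmax) (hV : VOORegular M D δ ω L) (Ca Cs : ℕ) : ∀ h, ∀ s,
    ∀ᵐ t ∂(treeLaw M δ ω Ca Cs h s), ActionsIn M.A h t
  | 0, _ => Eventually.of_forall fun _ => trivial
  | h + 1, s => by
    have ih := ae_actionsIn hM hV Ca Cs h
    have hm := measurableSet_actionsIn (S := S) hM.measurableSet_A Ca Cs h
    have hb := measurableSet_actionsIn_branch hM.measurableSet_A hm
    have hle := nodeLaw_exists_le (δ := δ) hM hV (markovFamily_treeLaw hM hV Ca Cs h) s hb.compl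
      (θ := 0) (fun a ha => ?_) Ca
    · rw [mul_zero, nonpos_iff_eq_zero] at hle
      refine measure_mono_null (fun t ht => ?_) hle
      have ht' : ¬ ∀ i : Fin Ca, (t i).1 ∈ M.A ∧ ∀ k, ActionsIn M.A h ((t i).2 k).2 := ht
      push Not at ht'
      obtain ⟨i, hi⟩ := ht'
      exact ⟨i, fun hc => by obtain ⟨k, hk⟩ := hi hc.1; exact hk (hc.2 k)⟩
    · rw [branchLaw_apply s a hb.compl]
      refine (measure_mono fun y hy => ?_).trans ((branchLaw_exists_le hM
        (markovFamily_treeLaw hM hV Ca Cs h) s a (measurable_snd hm.compl) (θ := 0)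
        fun s' => (ih s').le).trans (by simp))
      by_contra hcon
      exact hy ⟨ha, fun k => by_contra fun hk => hcon ⟨k, hk⟩⟩

theorem abs_vMid_le_of_forall (hM : M.Regular Rmax) {Ca Cs h : ℕ}
    (hv : ∀ s, |vMean M δ ω Ca Cs h s| ≤ M.Vmax Rmax) (s : S) {t : Tree S n Ca Cs (h + 1)}
    (ht : ActionsIn M.A (h + 1) t) : |vMid M δ ω Ca Cs (h + 1) s t| ≤ M.Vmax Rmax :=
  abs_iSup_le_of_finite (hM.Vmax_nonneg s) fun i => abs_lookahead_le hM hv s (ht i).1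

theorem abs_vMean_le (hM : M.Regular Rmax) (hV : VOORegular M D δ ω L) (Ca Cs : ℕ) : ∀ h s,
    |vMean M δ ω Ca Cs h s| ≤ M.Vmax Rmax
  | 0, s => by simpa [vMean] using hM.Vmax_nonneg s
  | h + 1, s => by
    have := (markovFamily_treeLaw hM hV Ca Cs (h + 1)).prob s
    rw [vMean_eq_integral_vMid]
    refine abs_integral_le_of_abs_le ?_
    filter_upwards [ae_actionsIn hM hV Ca Cs (h + 1) s] with t ht
    exact abs_vMid_le_of_forall hM (abs_vMean_le hM hV Ca Cs h) s ht

theorem abs_vMid_le (hM : M.Regular Rmax) (hV : VOORegular M D δ ω L) (Ca Cs : ℕ) : ∀ h s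
    {t : Tree S n Ca Cs h}, ActionsIn M.A h t → |vMid M δ ω Ca Cs h s t| ≤ M.Vmax Rmax
  | 0, s, _, _ => by simpa [vMid] using hM.Vmax_nonneg s
  | h + 1, s, _, ht => abs_vMid_le_of_forall hM (abs_vMean_le hM hV Ca Cs h) s ht

omit [MeasurableSpace S] in
theorem Branch.abs_avg_le {Ca Cs h : ℕ} (b : Branch S n Ca Cs h) {f : S → Tree S n Ca Cs h → ℝ}
    {C : ℝ} (hC : 0 ≤ C) (hf : ∀ k, |f (b.2 k).1 (b.2 k).2| ≤ C) : |b.avg f| ≤ C := by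
  unfold Branch.avg
  rw [abs_mul, abs_of_nonneg (by positivity : (0 : ℝ) ≤ (Cs : ℝ)⁻¹)]
  rcases Nat.eq_zero_or_pos Cs with rfl | hCs
  · simpa using hC
  · have hCs' : (0 : ℝ) < Cs := by exact_mod_cast hCs
    rw [inv_mul_le_iff₀ hCs']
    exact (Finset.abs_sum_le_sum_abs _ _).trans
      ((Finset.sum_le_sum fun k _ => hf k).trans (by simp))

omit [MeasurableSpace S] in
theorem Branch.avg_sub {Ca Cs h : ℕ} (b : Branch S n Ca Cs h) (f g : S → Tree S n Ca Cs h → ℝ) :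
    b.avg f - b.avg g = b.avg fun s t => f s t - g s t := by
  simp [Branch.avg, Finset.sum_sub_distrib, mul_sub]

theorem abs_vHat_le (hM : M.Regular Rmax) (Ca Cs : ℕ) : ∀ h s {t : Tree S n Ca Cs h},
    ActionsIn M.A h t → |vHat M Ca Cs h s t| ≤ M.Vmax Rmax
  | 0, s, _, _ => by simpa [vHat] using hM.Vmax_nonneg s
  | h + 1, s, t, ht => abs_iSup_le_of_finite (hM.Vmax_nonneg s) fun i =>
      hM.abs_reward_add_le (ht i).1 (Branch.abs_avg_le _ (hM.Vmax_nonneg s) fun k =>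
        abs_vHat_le hM Ca Cs h _ ((ht i).2 k))

end Bounds

/-! ### Concentration over the whole tree. -/

section Concentration

theorem integrable_of_abs_le {X : Type*} [MeasurableSpace X] {μ : Measure X}
    [IsProbabilityMeasure μ] {f : X → ℝ} (hm : Measurable f) {C : ℝ}
    (hf : ∀ᵐ x ∂μ, |f x| ≤ C) : Integrable f μ :=
  Integrable.of_bound hm.aestronglyMeasurable C hf

theorem ae_stateLaw_abs_vMid_le (hM : M.Regular Rmax) (hV : VOORegular M D δ ω L) (Ca Cs h : ℕ)
    (s : S) (a : Action n) :
    ∀ᵐ x ∂(stateLaw M (treeLaw M δ ω Ca Cs h) s a),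
      |vMid M δ ω Ca Cs h x.1 x.2| ≤ M.Vmax Rmax := by
  have hm := measurableSet_actionsIn (S := S) hM.measurableSet_A Ca Cs h
  have h0 : ∀ᵐ x ∂(stateLaw M (treeLaw M δ ω Ca Cs h) s a), ActionsIn M.A h x.2 :=
    nonpos_iff_eq_zero.1 (stateLaw_le hM (markovFamily_treeLaw hM hV Ca Cs h) s a
      (measurable_snd hm.compl) fun s' => (ae_actionsIn hM hV Ca Cs h s').le)
  exact h0.mono fun x hx => abs_vMid_le hM hV Ca Cs h x.1 hx

/-- Identifies the centering constant in `AllWithin` with the mean of one sample, as Hoeffding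
requires. -/
theorem integral_stateLaw_vMid (hM : M.Regular Rmax) (hV : VOORegular M D δ ω L) (Ca Cs h : ℕ)
    (s : S) (a : Action n) :
    ∫ x, vMid M δ ω Ca Cs h x.1 x.2 ∂(stateLaw M (treeLaw M δ ω Ca Cs h) s a) =
      ∫ s', vMean M δ ω Ca Cs h s' ∂(M.T (s, a)) := by
  have hsub := markovFamily_treeLaw hM hV Ca Cs h
  have := (markovFamily_stateLaw hM hsub).prob (s, a)
  rw [integral_stateLaw hM hsub s a (integrable_of_abs_le (measurable_vMid hM hV Ca Cs h)
    (ae_stateLaw_abs_vMid_le hM hV Ca Cs h s a))]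
  simp_rw [vMean_eq_integral_vMid]

/-- The number of actions in a tree with `h` steps to go. -/
def actionCount (Ca Cs h : ℕ) : ℝ :=
  ∑ j ∈ Finset.range h, (Ca : ℝ) * ((Ca : ℝ) * Cs) ^ j

theorem actionCount_nonneg (Ca Cs h : ℕ) : 0 ≤ actionCount Ca Cs h :=
  Finset.sum_nonneg fun _ _ => by positivity

/-- Splitting at the root: each of the `Ca` actions counts itself and the actions in its `Cs`
subtrees. -/
theorem actionCount_succ (Ca Cs h : ℕ) :
    actionCount Ca Cs (h + 1) = Ca * (1 + Cs * actionCount Ca Cs h) := by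
  unfold actionCount
  rw [Finset.sum_range_succ', ← Finset.mul_sum, ← Finset.mul_sum]
  simp_rw [pow_succ]
  rw [← Finset.sum_mul]
  ring

theorem actionCount_mono (Ca Cs : ℕ) {h h' : ℕ} (hh : h ≤ h') :
    actionCount Ca Cs h ≤ actionCount Ca Cs h' :=
  Finset.sum_le_sum_of_subset_of_nonneg (Finset.range_mono hh) fun _ _ _ => by positivity

/-- Every action in the tree costs one Hoeffding failure probability. Adaptivity is harmless because
the bound for a branch is uniform in its action. -/
theorem treeLaw_not_allWithin_le (hM : M.Regular Rmax) (hV : VOORegular M D δ ω L) {Ca Cs : ℕ}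
    (hCs : 1 ≤ Cs) {ε : ℝ} (hε : 0 ≤ ε) : ∀ h s,
    treeLaw M δ ω Ca Cs h s {t | ¬ AllWithin M δ ω Ca Cs ε h s t} ≤
      ENNReal.ofReal (actionCount Ca Cs h *
        (2 * Real.exp (-(2 * ε ^ 2 * Cs / (2 * M.Vmax Rmax) ^ 2))))
  | 0, s => by simp [AllWithin]
  | h + 1, s => by
    have ih := treeLaw_not_allWithin_le hM hV (Ca := Ca) hCs hε h
    set q : ℝ := 2 * Real.exp (-(2 * ε ^ 2 * Cs / (2 * M.Vmax Rmax) ^ 2)) with hq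
    have hq0 : 0 ≤ q := by positivity
    have hsub := markovFamily_treeLaw hM hV Ca Cs h
    have hm := measurableSet_allWithin hM hV Ca Cs ε h
    have hB : MeasurableSet (badBranch M δ ω Ca Cs ε h s) :=
      measurable_prodMk_left (x := s) (measurableSet_badBranch_prod hM hV hm)
    -- The budget of one branch: `q` for its own average, plus the inductive bound for each of its
    -- `Cs` subtrees.
    have hle := nodeLaw_exists_le (δ := δ) hM hV hsub s hB
      (θ := ENNReal.ofReal (q + Cs * (actionCount Ca Cs h * q))) (fun a ha => ?_) Ca
    · have heq : {t : Fin Ca → Branch S n Ca Cs h | ¬ AllWithin M δ ω Ca Cs ε (h + 1) s t} =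
          {t | ∃ i, t i ∈ badBranch M δ ω Ca Cs ε h s} := by
        ext t; simp [allWithin_succ_iff]
      show nodeLaw M δ ω Ca Cs h (treeLaw M δ ω Ca Cs h) s Ca
        {t : Fin Ca → Branch S n Ca Cs h | ¬ AllWithin M δ ω Ca Cs ε (h + 1) s t} ≤ _
      rw [heq]
      refine hle.trans (le_of_eq ?_)
      rw [actionCount_succ, ← ENNReal.ofReal_natCast, ← ENNReal.ofReal_mul (by positivity)]
      congr 1
      ring
    · have := (markovFamily_stateLaw hM hsub).prob (s, a)
      rw [branchLaw_apply s a hB, ENNReal.ofReal_add hq0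
        (mul_nonneg (by positivity) (mul_nonneg (actionCount_nonneg _ _ _) hq0)),
        ENNReal.ofReal_mul (p := (Cs : ℝ)) (by positivity), ENNReal.ofReal_natCast]
      refine (measure_mono fun y hy => ?_).trans ((measure_union_le _ _).trans (add_le_add
        (pi_avg_deviation_le (stateLaw M (treeLaw M δ ω Ca Cs h) s a) hCs
          (measurable_vMid hM hV Ca Cs h) (ae_stateLaw_abs_vMid_le hM hV Ca Cs h s a) hε)
        (branchLaw_exists_le hM hsub s a hm.compl ih)))
      rw [integral_stateLaw_vMid hM hV]
      by_contra hcon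
      refine hy ⟨le_of_not_gt fun hlt => hcon (Or.inl hlt), fun k => by_contra fun hk =>
        hcon (Or.inr ⟨k, hk⟩)⟩

theorem concentrated_of_le (hM : M.Regular Rmax) (hV : VOORegular M D δ ω L) {Ca Cs : ℕ}
    (hCs : 1 ≤ Cs) {ε p : ℝ} (hε : 0 ≤ ε)
    (hp : 2 * actionCount Ca Cs D * Real.exp (-(2 * ε ^ 2 * Cs / (2 * M.Vmax Rmax) ^ 2)) ≤ p) :
    Concentrated M D δ ω Ca Cs ε p := by
  intro d _ s
  have := (markovFamily_treeLaw hM hV Ca Cs (D - d)).prob s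
  have hm : MeasurableSet {t | AllWithin M δ ω Ca Cs ε (D - d) s t} :=
    measurable_prodMk_left (x := s) (measurableSet_allWithin hM hV Ca Cs ε (D - d))
  have h1 : (treeLaw M δ ω Ca Cs (D - d) s).real {t | AllWithin M δ ω Ca Cs ε (D - d) s t}ᶜ ≤
      p := by
    refine (ENNReal.toReal_mono ENNReal.ofReal_ne_top
      (treeLaw_not_allWithin_le hM hV hCs hε (D - d) s)).trans ?_
    rw [ENNReal.toReal_ofReal (mul_nonneg (actionCount_nonneg _ _ _) (by positivity))]
    refine le_trans ?_ hp
    have := actionCount_mono Ca Cs (Nat.sub_le D d)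
    nlinarith [Real.exp_pos (-(2 * ε ^ 2 * Cs / (2 * M.Vmax Rmax) ^ 2))]
  rw [probReal_compl_eq_one_sub hm] at h1
  linarith

end Concentration

/-! ### Comparison with the optimal values. -/

section Optimal

theorem exists_maximizer (hV : VOORegular M D δ ω L) {h : ℕ} (hh : h < D) (s : S) :
    ∃ a' ∈ M.A, ∀ a ∈ M.A, M.lookahead (M.vStar h) s a ≤ M.lookahead (M.vStar h) s a' ∧
      M.lookahead (M.vStar h) s a' - M.lookahead (M.vStar h) s a ≤ L * δ a a' := by
  have h1 := hV.smooth.2 (D - (h + 1)) (by omega) s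
  unfold MDP.qStar at h1
  rwa [show D - (D - (h + 1) + 1) = h by omega] at h1

theorem vStar_succ_eq {h : ℕ} {s : S} {a' : Action n} (ha' : a' ∈ M.A)
    (hmax : ∀ a ∈ M.A, M.lookahead (M.vStar h) s a ≤ M.lookahead (M.vStar h) s a') :
    M.vStar (h + 1) s = M.lookahead (M.vStar h) s a' := by
  have : Nonempty M.A := ⟨⟨a', ha'⟩⟩
  exact le_antisymm (ciSup_le fun a => hmax a a.2)
    (le_ciSup (f := fun a : M.A => M.lookahead (M.vStar h) s a)
      ⟨_, by rintro _ ⟨a, rfl⟩; exact hmax a a.2⟩ ⟨a', ha'⟩)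

theorem lookahead_le_vStar (hV : VOORegular M D δ ω L) {h : ℕ} (hh : h < D) (s : S)
    {a : Action n} (ha : a ∈ M.A) : M.lookahead (M.vStar h) s a ≤ M.vStar (h + 1) s := by
  obtain ⟨a', ha', hmax⟩ := exists_maximizer hV hh s
  rw [vStar_succ_eq ha' fun a ha => (hmax a ha).1]
  exact (hmax a ha).1

theorem measurableSet_ball (hM : M.Regular Rmax) (hV : VOORegular M D δ ω L) (r : ℝ)
    (a : Action n) : MeasurableSet {x ∈ M.A | δ x a < r} :=
  hM.measurableSet_A.inter
    (measurableSet_lt (hV.measurable_dist.comp measurable_prodMk_right) measurable_const)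

theorem volume_ball_pos (hM : M.Regular Rmax) (hV : VOORegular M D δ ω L) {r : ℝ} (hr : 0 < r)
    {a : Action n} (ha : a ∈ M.A) : 0 < volume {x ∈ M.A | δ x a < r} := by
  obtain ⟨c, hc, hball⟩ := hV.ball_volume r hr
  exact (ENNReal.mul_pos hc.ne' hM.volume_pos.ne').trans_le (hball a ha)

/-- The optimal value function is measurable: by the regularity around a maximizer, its supremum
over `A` is an essential supremum. -/
theorem measurable_vStar (hM : M.Regular Rmax) (hV : VOORegular M D δ ω L) : ∀ {h : ℕ}, h ≤ D →
    Measurable (M.vStar h)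
  | 0, _ => measurable_const
  | h + 1, hh => by
    have hf := measurable_lookahead hM (measurable_vStar hM hV (Nat.le_of_succ_le hh))
    refine measurable_of_Ioi fun c => ?_
    have hset : M.vStar (h + 1) ⁻¹' Set.Ioi c = {s | 0 < (volume.restrict M.A)
        (Prod.mk s ⁻¹' {p : S × Action n | c < M.lookahead (M.vStar h) p.1 p.2})} := by
      ext s
      have hm : MeasurableSet {a | c < M.lookahead (M.vStar h) s a} :=
        measurableSet_lt measurable_const (hf.comp measurable_prodMk_left)
      show c < M.vStar (h + 1) s ↔
        0 < (volume.restrict M.A) {a | c < M.lookahead (M.vStar h) s a}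
      rw [Measure.restrict_apply hm]
      constructor
      · intro hc
        obtain ⟨a', ha', hmax⟩ := exists_maximizer hV hh s
        rw [vStar_succ_eq ha' fun a ha => (hmax a ha).1] at hc
        have hL := hV.smooth.1
        -- The radius is the excess over `c` divided by `L`, so smoothness keeps the action value
        -- above `c` on the whole ball, which has positive volume.
        refine (volume_ball_pos hM hV (div_pos (sub_pos.2 hc) hL) ha').trans_le
          (measure_mono fun a ha => ⟨?_, ha.1⟩)
        have h1 := (hmax a ha.1).2
        have h2 : L * δ a a' < M.lookahead (M.vStar h) s a' - c := by
          have h3 : δ a a' < (M.lookahead (M.vStar h) s a' - c) / L := ha.2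
          rw [lt_div_iff₀ hL] at h3
          linarith
        show c < M.lookahead (M.vStar h) s a
        linarith
      · intro hpos
        obtain ⟨a, ha, haA⟩ := nonempty_of_measure_ne_zero hpos.ne'
        exact lt_of_lt_of_le ha (lookahead_le_vStar hV hh s haA)
    rw [hset]
    exact measurableSet_lt measurable_const
      (measurable_measure_prodMk_left (measurableSet_lt measurable_const hf))

theorem abs_vStar_le (hM : M.Regular Rmax) (hV : VOORegular M D δ ω L) : ∀ {h : ℕ}, h ≤ D →
    ∀ s, |M.vStar h s| ≤ M.Vmax Rmax
  | 0, _, s => by simpa [MDP.vStar] using hM.Vmax_nonneg s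
  | h + 1, hh, s => by
    obtain ⟨a', ha', hmax⟩ := exists_maximizer hV hh s
    rw [vStar_succ_eq ha' fun a ha => (hmax a ha).1]
    exact abs_lookahead_le hM (abs_vStar_le hM hV (Nat.le_of_succ_le hh)) s ha'

/-- One-sided contraction of the Bellman step. With `c = 0` it is monotonicity; with `c` an error
bound it discounts that error. -/
theorem lookahead_le_add (hM : M.Regular Rmax) {v w : S → ℝ} (hv : Measurable v)
    (hw : Measurable w) {B : ℝ} (hvB : ∀ s, |v s| ≤ B) (hwB : ∀ s, |w s| ≤ B) {c : ℝ}
    (h : ∀ s, v s ≤ w s + c) (s : S) (a : Action n) :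
    M.lookahead v s a ≤ M.lookahead w s a + M.γ * c := by
  have := hM.markov
  have hvi : Integrable v (M.T (s, a)) := integrable_of_abs_le hv (Eventually.of_forall hvB)
  have hwi : Integrable w (M.T (s, a)) := integrable_of_abs_le hw (Eventually.of_forall hwB)
  have h1 : ∫ s', v s' ∂(M.T (s, a)) ≤ ∫ s', w s' ∂(M.T (s, a)) + c := by
    refine (integral_mono hvi (hwi.add (integrable_const c)) h).trans (le_of_eq ?_)
    simp only [Pi.add_apply]
    rw [integral_add hwi (integrable_const c)]
    simp
  have h2 := mul_le_mul_of_nonneg_left h1 hM.γ_nonneg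
  unfold MDP.lookahead
  linarith

theorem vMid_succ_le_of_forall (hM : M.Regular Rmax) (hV : VOORegular M D δ ω L) {Ca Cs h : ℕ}
    (hCa : 1 ≤ Ca) (hh : h < D) (hle : ∀ s, vMean M δ ω Ca Cs h s ≤ M.vStar h s) (s : S)
    {t : Tree S n Ca Cs (h + 1)} (ht : ActionsIn M.A (h + 1) t) :
    vMid M δ ω Ca Cs (h + 1) s t ≤ M.vStar (h + 1) s := by
  have : Nonempty (Fin Ca) := ⟨⟨0, hCa⟩⟩
  refine ciSup_le fun i => ?_
  have h1 := lookahead_le_add hM (measurable_vMean hM hV Ca Cs h)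
    (measurable_vStar hM hV hh.le) (abs_vMean_le hM hV Ca Cs h) (abs_vStar_le hM hV hh.le)
    (c := 0) (by simpa using hle) s (t i).1
  have h2 := lookahead_le_vStar hV hh s (ht i).1
  linarith

theorem integrable_vMid (hM : M.Regular Rmax) (hV : VOORegular M D δ ω L) (Ca Cs h : ℕ) (s : S) :
    Integrable (vMid M δ ω Ca Cs h s) (treeLaw M δ ω Ca Cs h s) := by
  have := (markovFamily_treeLaw hM hV Ca Cs h).prob s
  exact integrable_of_abs_le ((measurable_vMid hM hV Ca Cs h).comp measurable_prodMk_left)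
    ((ae_actionsIn hM hV Ca Cs h s).mono fun t ht => abs_vMid_le hM hV Ca Cs h s ht)

theorem integrable_vHat (hM : M.Regular Rmax) (hV : VOORegular M D δ ω L) (Ca Cs h : ℕ) (s : S) :
    Integrable (vHat M Ca Cs h s) (treeLaw M δ ω Ca Cs h s) := by
  have := (markovFamily_treeLaw hM hV Ca Cs h).prob s
  exact integrable_of_abs_le ((measurable_vHat hM Ca Cs h).comp measurable_prodMk_left)
    ((ae_actionsIn hM hV Ca Cs h s).mono fun t ht => abs_vHat_le hM Ca Cs h s ht)

theorem integral_sub_vMid (hM : M.Regular Rmax) (hV : VOORegular M D δ ω L) (Ca Cs h : ℕ) (s : S)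
    (c : ℝ) : ∫ t, (c - vMid M δ ω Ca Cs h s t) ∂(treeLaw M δ ω Ca Cs h s) =
      c - vMean M δ ω Ca Cs h s := by
  have := (markovFamily_treeLaw hM hV Ca Cs h).prob s
  rw [integral_sub (integrable_const c) (integrable_vMid hM hV Ca Cs h s),
    vMean_eq_integral_vMid]
  simp

theorem vMean_le_vStar (hM : M.Regular Rmax) (hV : VOORegular M D δ ω L) {Ca : ℕ} (Cs : ℕ)
    (hCa : 1 ≤ Ca) : ∀ {h : ℕ}, h ≤ D → ∀ s, vMean M δ ω Ca Cs h s ≤ M.vStar h s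
  | 0, _, _ => le_rfl
  | h + 1, hh, s => by
    have := (markovFamily_treeLaw hM hV Ca Cs (h + 1)).prob s
    rw [vMean_eq_integral_vMid]
    refine (integral_mono_ae (integrable_vMid hM hV Ca Cs (h + 1) s)
      (integrable_const (M.vStar (h + 1) s)) ?_).trans (by simp)
    filter_upwards [ae_actionsIn hM hV Ca Cs (h + 1) s] with t ht
    exact vMid_succ_le_of_forall hM hV hCa hh
      (vMean_le_vStar hM hV Cs hCa (Nat.le_of_succ_le hh)) s ht

theorem vMid_le_vStar (hM : M.Regular Rmax) (hV : VOORegular M D δ ω L) {Ca : ℕ} (Cs : ℕ)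
    (hCa : 1 ≤ Ca) : ∀ {h : ℕ}, h ≤ D → ∀ s {t : Tree S n Ca Cs h}, ActionsIn M.A h t →
      vMid M δ ω Ca Cs h s t ≤ M.vStar h s
  | 0, _, _, _, _ => le_rfl
  | _ + 1, hh, s, _, ht =>
    vMid_succ_le_of_forall hM hV hCa hh (vMean_le_vStar hM hV Cs hCa (Nat.le_of_succ_le hh)) s ht

theorem lookahead_le_vSup (hM : M.Regular Rmax) (hV : VOORegular M D δ ω L) (Ca Cs h : ℕ) (s : S)
    {a : Action n} (ha : a ∈ M.A) :
    M.lookahead (vMean M δ ω Ca Cs h) s a ≤ vSup M δ ω Ca Cs (h + 1) s :=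
  le_ciSup (f := fun a : M.A => M.lookahead (vMean M δ ω Ca Cs h) s a)
    ⟨M.Vmax Rmax, by
      rintro _ ⟨a, rfl⟩
      exact (abs_le.1 (abs_lookahead_le hM (abs_vMean_le hM hV Ca Cs h) s a.2)).2⟩ ⟨a, ha⟩

theorem vSup_le_vStar (hM : M.Regular Rmax) (hV : VOORegular M D δ ω L) {Ca : ℕ} (Cs : ℕ)
    (hCa : 1 ≤ Ca) : ∀ {h : ℕ}, h ≤ D → ∀ s, vSup M δ ω Ca Cs h s ≤ M.vStar h s
  | 0, _, _ => le_rfl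
  | h + 1, hh, s => by
    have : Nonempty M.A := hM.nonempty.to_subtype
    refine ciSup_le fun a => ?_
    have hh' := Nat.le_of_succ_le hh
    have h1 := lookahead_le_add hM (measurable_vMean hM hV Ca Cs h)
      (measurable_vStar hM hV hh') (abs_vMean_le hM hV Ca Cs h) (abs_vStar_le hM hV hh')
      (c := 0) (by simpa using vMean_le_vStar hM hV Cs hCa hh') s a
    have h2 := lookahead_le_vStar hV hh s a.2
    linarith

/-- The bias of the VOO step without state sampling. -/
theorem vStar_le_vMean_add (hM : M.Regular Rmax) (hV : VOORegular M D δ ω L) {Ca Cs : ℕ}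
    {ρ : ℝ} {η : ℕ → ℝ} (hρ : RegretBound M D δ ω Ca Cs ρ) (hη : IsEta M.γ D ρ η) :
    ∀ {h : ℕ}, h ≤ D → ∀ s, M.vStar h s ≤ vMean M δ ω Ca Cs h s + η (D - h)
  | 0, _, _ => by simp [MDP.vStar, vMean, hη.2]
  | h + 1, hh, s => by
    have hh' := Nat.le_of_succ_le hh
    have ih := vStar_le_vMean_add hM hV hρ hη hh'
    obtain ⟨a', ha', hmax⟩ := exists_maximizer hV hh s
    rw [vStar_succ_eq ha' fun a ha => (hmax a ha).1]
    -- At the optimal action, pass from `vStar` to `vMean` at cost `γ * η (D - h)`, then to `vSup`,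
    -- then to `vMean` at the current level at cost `ρ`.
    have h1 := lookahead_le_add hM (measurable_vStar hM hV hh') (measurable_vMean hM hV Ca Cs h)
      (abs_vStar_le hM hV hh') (abs_vMean_le hM hV Ca Cs h) ih s a'
    have h2 := lookahead_le_vSup (δ := δ) hM hV Ca Cs h s ha'
    have h3 := hρ (D - (h + 1)) (by omega) s
    rw [integral_sub_vMid hM hV, show D - (D - (h + 1)) = h + 1 by omega] at h3
    have h4 := hη.1 (D - (h + 1)) (by omega)
    rw [show D - (h + 1) + 1 = D - h by omega] at h4
    linarith

end Optimal

/-! ### Propagation of the sampling error and the finite-width bound. -/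

section Sampling

/-- The accumulated discounted sampling error, in units of the error of a single average. -/
def errCoeff (γ : ℝ) : ℕ → ℝ
  | 0 => 0
  | h + 1 => γ * (errCoeff γ h + 1)

/-- The solution of the recursion of `IsAlpha`, in units of `ε + 2 * p * Vmax`. -/
def alphaCoeff (γ : ℝ) : ℕ → ℝ
  | 0 => 1
  | 1 => 1
  | h + 2 => γ * (alphaCoeff γ (h + 1) + 1)

theorem errCoeff_nonneg {γ : ℝ} (hγ : 0 ≤ γ) : ∀ h, 0 ≤ errCoeff γ h
  | 0 => le_rfl
  | h + 1 => mul_nonneg hγ (by linarith [errCoeff_nonneg hγ h])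

theorem errCoeff_le_alphaCoeff {γ : ℝ} (hγ : 0 ≤ γ) (hγ1 : γ ≤ 1) : ∀ h,
    errCoeff γ h ≤ alphaCoeff γ h
  | 0 => zero_le_one
  | 1 => by simpa [errCoeff, alphaCoeff] using hγ1
  | h + 2 => mul_le_mul_of_nonneg_left
      (by linarith [errCoeff_le_alphaCoeff hγ hγ1 (h + 1)]) hγ

theorem IsAlpha.eq_alphaCoeff {γ V ε p : ℝ} {α : ℕ → ℝ} (hα : IsAlpha γ V D ε p α) :
    ∀ {h : ℕ}, h + 1 ≤ D → α (D - (h + 1)) = alphaCoeff γ (h + 1) * (ε + 2 * p * V)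
  | 0, _ => by rw [hα.1]; simp [alphaCoeff]
  | h + 1, hh => by
    have h1 := hα.2 (D - (h + 1 + 1)) (by omega)
    rw [show D - (h + 1 + 1) + 1 = D - (h + 1) by omega,
      hα.eq_alphaCoeff (Nat.le_of_succ_le hh)] at h1
    rw [h1, alphaCoeff]
    ring

theorem le_maxDepth {d : ℕ} (hd : d < D) (f : ℕ → ℝ) : f d ≤ maxDepth D f :=
  le_ciSup (f := fun d : Fin D => f d) (Set.finite_range _).bddAbove ⟨d, hd⟩

/-- The failure term `2 * p * V` is undiscounted, so `α` at the depth in question dominates only if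
its coefficient is at least `1`. Otherwise `errCoeff` is at most `1` too and `α (D - 1) = ε + 2 * p
* V` suffices. This is where the maximum over depths is needed. -/
theorem IsAlpha.le_maxDepth {γ V ε p : ℝ} (hγ : 0 ≤ γ) (hγ1 : γ ≤ 1) {α : ℕ → ℝ}
    (hα : IsAlpha γ V D ε p α) (hε : 0 ≤ ε) (hp : 0 ≤ p * V) {h : ℕ} (h0 : 0 < h) (hh : h ≤ D) :
    errCoeff γ h * ε + 2 * p * V ≤ maxDepth D α := by
  obtain ⟨h, rfl⟩ := Nat.exists_eq_add_of_lt h0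
  rw [zero_add] at hh ⊢
  have h1 := VOSS.le_maxDepth (D := D) (d := D - 1) (by omega) α
  have h2 := VOSS.le_maxDepth (D := D) (d := D - (h + 1)) (by omega) α
  rw [hα.1] at h1
  rw [hα.eq_alphaCoeff hh] at h2
  have h3 := errCoeff_le_alphaCoeff hγ hγ1 (h + 1)
  rcases le_total 1 (alphaCoeff γ (h + 1)) with hc | hc
  · nlinarith
  · nlinarith

theorem abs_vMid_sub_vHat_le (hM : M.Regular Rmax) {Ca Cs : ℕ} {ε : ℝ} (hε : 0 ≤ ε) : ∀ h s
    {t : Tree S n Ca Cs h}, AllWithin M δ ω Ca Cs ε h s t →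
      |vMid M δ ω Ca Cs h s t - vHat M Ca Cs h s t| ≤ errCoeff M.γ h * ε
  | 0, _, _, _ => by simp [vMid, vHat, errCoeff]
  | h + 1, s, t, ht => by
    have hc := errCoeff_nonneg hM.γ_nonneg h
    refine abs_iSup_sub_iSup_le (mul_nonneg (errCoeff_nonneg hM.γ_nonneg (h + 1)) hε) fun i => ?_
    have h1 := (ht i).1
    have h2 := Branch.abs_avg_le (t i) (f := fun s t => vMid M δ ω Ca Cs h s t - vHat M Ca Cs h s t)
      (mul_nonneg hc hε) fun k => abs_vMid_sub_vHat_le hM hε h _ ((ht i).2 k)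
    rw [← Branch.avg_sub] at h2
    -- Inserting the sample average of `vMid` splits the error into the averaged error of the
    -- subtrees and the deviation of this one average.
    have h3 : M.lookahead (vMean M δ ω Ca Cs h) s (t i).1 -
        (M.R s (t i).1 + M.γ * Branch.avg (t i) (vHat M Ca Cs h)) =
        M.γ * ((Branch.avg (t i) (vMid M δ ω Ca Cs h) - Branch.avg (t i) (vHat M Ca Cs h)) -
          (Branch.avg (t i) (vMid M δ ω Ca Cs h) -
            ∫ s', vMean M δ ω Ca Cs h s' ∂(M.T (s, (t i).1)))) := by
      unfold MDP.lookahead; ring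
    rw [h3, abs_mul, abs_of_nonneg hM.γ_nonneg, errCoeff, mul_assoc, add_mul, one_mul]
    exact mul_le_mul_of_nonneg_left ((abs_sub _ _).trans (add_le_add h2 h1)) hM.γ_nonneg

theorem integral_abs_vMid_sub_vHat_le (hM : M.Regular Rmax) (hV : VOORegular M D δ ω L)
    {Ca Cs : ℕ} {ε p : ℝ} (hε : 0 ≤ ε) {h : ℕ} {s : S}
    (hp : 1 - p ≤ (treeLaw M δ ω Ca Cs h s).real {t | AllWithin M δ ω Ca Cs ε h s t}) :
    ∫ t, |vMid M δ ω Ca Cs h s t - vHat M Ca Cs h s t| ∂(treeLaw M δ ω Ca Cs h s) ≤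
      errCoeff M.γ h * ε + 2 * p * M.Vmax Rmax := by
  have := (markovFamily_treeLaw hM hV Ca Cs h).prob s
  have hVm := hM.Vmax_nonneg s
  have hc := mul_nonneg (errCoeff_nonneg hM.γ_nonneg h) hε
  have hm : MeasurableSet {t | AllWithin M δ ω Ca Cs ε h s t} :=
    measurable_prodMk_left (x := s) (measurableSet_allWithin hM hV Ca Cs ε h)
  have hbound : ∀ᵐ t ∂(treeLaw M δ ω Ca Cs h s),
      |vMid M δ ω Ca Cs h s t - vHat M Ca Cs h s t| ≤ errCoeff M.γ h * ε +
        {t | AllWithin M δ ω Ca Cs ε h s t}ᶜ.indicator (fun _ => 2 * M.Vmax Rmax) t := by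
    filter_upwards [ae_actionsIn hM hV Ca Cs h s] with t ht
    by_cases hw : AllWithin M δ ω Ca Cs ε h s t
    · have := abs_vMid_sub_vHat_le hM hε h s hw
      simpa [hw] using this
    · have h1 := abs_vMid_le hM hV Ca Cs h s ht
      have h2 := abs_vHat_le hM Ca Cs h s ht
      have h3 := abs_sub (vMid M δ ω Ca Cs h s t) (vHat M Ca Cs h s t)
      rw [Set.indicator_of_mem (by exact hw)]
      linarith
  refine (integral_mono_ae ((integrable_vMid hM hV Ca Cs h s).sub
    (integrable_vHat hM hV Ca Cs h s)).abs ((integrable_const _).add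
      ((integrable_const _).indicator hm.compl)) hbound).trans ?_
  simp only [Pi.add_apply]
  rw [integral_add (integrable_const _) ((integrable_const _).indicator hm.compl),
    integral_indicator_const _ hm.compl, probReal_compl_eq_one_sub hm]
  simp only [integral_const, probReal_univ, smul_eq_mul, one_mul]
  nlinarith

theorem integral_abs_vStar_sub_vHat_le (hM : M.Regular Rmax) (hV : VOORegular M D δ ω L)
    {Ca Cs : ℕ} (hCa : 1 ≤ Ca) {ρ ε p : ℝ} {η α : ℕ → ℝ} (hε : 0 ≤ ε)
    (hρ : RegretBound M D δ ω Ca Cs ρ) (hp : Concentrated M D δ ω Ca Cs ε p)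
    (hη : IsEta M.γ D ρ η) (hα : IsAlpha M.γ (M.Vmax Rmax) D ε p α) {d : ℕ} (hd : d < D) (s : S) :
    Integrable (fun t => |M.vStar (D - d) s - vHat M Ca Cs (D - d) s t|)
        (treeLaw M δ ω Ca Cs (D - d) s) ∧
      ∫ t, |M.vStar (D - d) s - vHat M Ca Cs (D - d) s t| ∂(treeLaw M δ ω Ca Cs (D - d) s)
        ≤ maxDepth D η + maxDepth D α := by
  have := (markovFamily_treeLaw hM hV Ca Cs (D - d)).prob s
  have hi := integrable_vHat hM hV Ca Cs (D - d) s
  have hi' := integrable_vMid hM hV Ca Cs (D - d) s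
  have hint : Integrable (fun t => |M.vStar (D - d) s - vHat M Ca Cs (D - d) s t|)
      (treeLaw M δ ω Ca Cs (D - d) s) := ((integrable_const _).sub hi).abs
  refine ⟨hint, ?_⟩
  have hi1 : Integrable (fun t => M.vStar (D - d) s - vMid M δ ω Ca Cs (D - d) s t)
      (treeLaw M δ ω Ca Cs (D - d) s) := (integrable_const _).sub hi'
  have hi2 : Integrable (fun t => |vMid M δ ω Ca Cs (D - d) s t - vHat M Ca Cs (D - d) s t|)
      (treeLaw M δ ω Ca Cs (D - d) s) := (hi'.sub hi).abs
  -- The lower bound `1 - p` on a probability forces `p ≥ 0`.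
  have hp0 : 0 ≤ p := by
    have h1 := hp d hd s
    have h2 : (treeLaw M δ ω Ca Cs (D - d) s).real
      {t | AllWithin M δ ω Ca Cs ε (D - d) s t} ≤ 1 := measureReal_le_one
    linarith
  have hbias := vStar_le_vMean_add hM hV hρ hη (Nat.sub_le D d) s
  rw [show D - (D - d) = d by omega] at hbias
  have hmaxη := le_maxDepth hd η
  have hmaxα := hα.le_maxDepth hM.γ_nonneg hM.γ_lt_one.le hε
    (mul_nonneg hp0 (hM.Vmax_nonneg s)) (Nat.sub_pos_of_lt hd) (Nat.sub_le D d)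
  have hdev := integral_abs_vMid_sub_vHat_le hM hV hε (hp d hd s)
  calc ∫ t, |M.vStar (D - d) s - vHat M Ca Cs (D - d) s t| ∂(treeLaw M δ ω Ca Cs (D - d) s)
      ≤ ∫ t, ((M.vStar (D - d) s - vMid M δ ω Ca Cs (D - d) s t) +
          |vMid M δ ω Ca Cs (D - d) s t - vHat M Ca Cs (D - d) s t|)
          ∂(treeLaw M δ ω Ca Cs (D - d) s) := by
        refine integral_mono_ae hint (hi1.add hi2) ?_
        -- Since `vMid ≤ vStar` here, the first term needs no absolute value, and its integral is
        -- exactly the bias.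
        filter_upwards [ae_actionsIn hM hV Ca Cs (D - d) s] with t ht
        have h1 := vMid_le_vStar hM hV Cs hCa (Nat.sub_le D d) s ht
        have h2 := abs_sub_le (M.vStar (D - d) s) (vMid M δ ω Ca Cs (D - d) s t)
          (vHat M Ca Cs (D - d) s t)
        rwa [abs_of_nonneg (sub_nonneg.2 h1)] at h2
    _ = (M.vStar (D - d) s - vMean M δ ω Ca Cs (D - d) s) +
          ∫ t, |vMid M δ ω Ca Cs (D - d) s t - vHat M Ca Cs (D - d) s t|
            ∂(treeLaw M δ ω Ca Cs (D - d) s) := by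
        rw [integral_add hi1 hi2, integral_sub_vMid hM hV]
    _ ≤ maxDepth D η + maxDepth D α := by linarith

end Sampling

/-! ### Vanishing regret from uniform exploration. -/

section Exploration

/-- The rate is `1 - ω c`, with `c` the lower bound on relative ball volume. It is below `1` since
`ω c > 0`, and the same for every center. -/
theorem exists_missRate (hM : M.Regular Rmax) (hV : VOORegular M D δ ω L) (r : ℝ) (hr : 0 < r) :
    ∃ κ : ℝ, 0 ≤ κ ∧ κ < 1 ∧ ∀ a ∈ M.A,
      1 - ENNReal.ofReal ω * cond volume M.A {x ∈ M.A | δ x a < r} ≤ ENNReal.ofReal κ := by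
  obtain ⟨c, hc, hball⟩ := hV.ball_volume r hr
  have hne : 1 - ENNReal.ofReal ω * c ≠ ⊤ := ENNReal.sub_ne_top ENNReal.one_ne_top
  refine ⟨(1 - ENNReal.ofReal ω * c).toReal, ENNReal.toReal_nonneg, ?_, fun a ha => ?_⟩
  · have h : 1 - ENNReal.ofReal ω * c < 1 := ENNReal.sub_lt_self ENNReal.one_ne_top one_ne_zero
      (mul_ne_zero (ENNReal.ofReal_pos.2 hV.ω_pos).ne' hc.ne')
    simpa using (ENNReal.toReal_lt_toReal hne ENNReal.one_ne_top).2 h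
  · rw [ENNReal.ofReal_toReal hne]
    refine tsub_le_tsub_left (mul_le_mul_right ?_ _) 1
    rw [cond_apply hM.measurableSet_A, Set.inter_eq_self_of_subset_right fun x hx => hx.1,
      mul_comm, ← div_eq_mul_inv, ENNReal.le_div_iff_mul_le (Or.inl hM.volume_pos.ne')
        (Or.inl hM.volume_lt_top.ne)]
    exact hball a ha

/-- Taking the infimum over radii avoids choosing a radius for each `m`. It tends to `0` because,
for a target `a`, the fixed radius `a / (2 * L)` leaves `a / 2` plus a geometric term. -/
theorem exists_exploration_rate {κ : ℝ → ℝ} (hκ0 : ∀ r, 0 < r → 0 ≤ κ r)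
    (hκ1 : ∀ r, 0 < r → κ r < 1) {W : ℝ} (hL : 0 < L) (hW : 0 ≤ W) :
    ∃ g : ℕ → ℝ, (∀ m, 0 ≤ g m) ∧ Tendsto g atTop (𝓝 0) ∧
      ∀ m x, (∀ r, 0 < r → x ≤ L * r + W * κ r ^ m) → x ≤ g m := by
  have hne : Nonempty {r : ℝ // 0 < r} := ⟨⟨1, one_pos⟩⟩
  have hpos : ∀ m, ∀ r : {r : ℝ // 0 < r}, 0 ≤ L * r.1 + W * κ r ^ m := fun m r =>
    add_nonneg (mul_nonneg hL.le r.2.le) (mul_nonneg hW (pow_nonneg (hκ0 r r.2) m))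
  have hg0 : ∀ m, 0 ≤ ⨅ r : {r : ℝ // 0 < r}, (L * r.1 + W * κ r ^ m) := fun m =>
    le_ciInf (hpos m)
  refine ⟨fun m => ⨅ r : {r : ℝ // 0 < r}, (L * r.1 + W * κ r ^ m), hg0, ?_,
    fun m x hx => le_ciInf fun r => hx r r.2⟩
  refine tendsto_order.2 ⟨fun a ha => Eventually.of_forall fun m => ha.trans_le (hg0 m),
    fun a ha => ?_⟩
  have hr : 0 < a / (2 * L) := by positivity
  have ht : Tendsto (fun m => L * (a / (2 * L)) + W * κ (a / (2 * L)) ^ m) atTop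
      (𝓝 (L * (a / (2 * L)) + W * 0)) :=
    tendsto_const_nhds.add (tendsto_const_nhds.mul
      (tendsto_pow_atTop_nhds_zero_of_lt_one (hκ0 _ hr) (hκ1 _ hr)))
  have hlt : L * (a / (2 * L)) + W * 0 < a := by
    have : L * (a / (2 * L)) = a / 2 := by field_simp
    linarith
  filter_upwards [ht.eventually_lt_const hlt] with m hm
  exact (ciInf_le ⟨0, by rintro _ ⟨r, rfl⟩; exact hpos m r⟩ ⟨a / (2 * L), hr⟩).trans_lt hm

/-- Smoothness is known for `Q*`, not for the function the agent optimizes. An action within `r` of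
a maximizer of `Q*` loses `L * r`, and returning to the lookahead of `vMean` loses `γ * e`. If no
action lands there, the trivial bound `2 * Vmax` is used. -/
theorem vStar_succ_sub_vMean_le (hM : M.Regular Rmax) (hV : VOORegular M D δ ω L) {Ca Cs : ℕ}
    {h : ℕ} (hh : h < D) {e : ℝ} (he : 0 ≤ e)
    (hle : ∀ s, M.vStar h s ≤ vMean M δ ω Ca Cs h s + e) {r κ : ℝ} (hr : 0 < r) (hκ : 0 ≤ κ)
    (hmiss : ∀ a ∈ M.A,
      1 - ENNReal.ofReal ω * cond volume M.A {x ∈ M.A | δ x a < r} ≤ ENNReal.ofReal κ) (s : S) :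
    M.vStar (h + 1) s - vMean M δ ω Ca Cs (h + 1) s ≤
      M.γ * e + (L * r + 2 * M.Vmax Rmax * κ ^ Ca) := by
  have hL := hV.smooth.1
  have hVm := hM.Vmax_nonneg s
  have hp := (markovFamily_treeLaw hM hV Ca Cs (h + 1)).prob s
  obtain ⟨a', ha', hmax⟩ := exists_maximizer hV hh s
  have hvs := vStar_succ_eq ha' fun a ha => (hmax a ha).1
  set U : Set (Action n) := {x ∈ M.A | δ x a' < r}
  have hUm : MeasurableSet U := measurableSet_ball hM hV r a'
  let N : Set (Tree S n Ca Cs (h + 1)) := {t | ∀ i : Fin Ca, (t i).1 ∉ U}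
  have hN : MeasurableSet N := measurableSet_forall_notMem (k := Ca) hUm
  have hNp : (treeLaw M δ ω Ca Cs (h + 1) s).real N ≤ κ ^ Ca := by
    have h1 : treeLaw M δ ω Ca Cs (h + 1) s N ≤ ENNReal.ofReal (κ ^ Ca) := by
      rw [ENNReal.ofReal_pow hκ]
      exact (nodeLaw_forall_notMem_le hM hV (markovFamily_treeLaw hM hV Ca Cs h) s hUm Ca).trans
        (pow_le_pow_left' (hmiss a' ha') Ca)
    exact ENNReal.toReal_le_of_le_ofReal (pow_nonneg hκ _) h1
  have hbound : ∀ᵐ t ∂(treeLaw M δ ω Ca Cs (h + 1) s),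
      M.vStar (h + 1) s - vMid M δ ω Ca Cs (h + 1) s t ≤
        (M.γ * e + L * r) + N.indicator (fun _ => 2 * M.Vmax Rmax) t := by
    filter_upwards [ae_actionsIn hM hV Ca Cs (h + 1) s] with t ht
    have hpos : 0 ≤ M.γ * e + L * r :=
      add_nonneg (mul_nonneg hM.γ_nonneg he) (mul_nonneg hL.le hr.le)
    by_cases htN : t ∈ N
    · rw [Set.indicator_of_mem htN]
      have h1 := (abs_le.1 (abs_vStar_le hM hV hh s)).2
      have h2 := (abs_le.1 (abs_vMid_le hM hV Ca Cs (h + 1) s ht)).1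
      linarith
    · rw [Set.indicator_of_notMem htN]
      have htN' : ∃ i : Fin Ca, (t i).1 ∈ U := by
        by_contra hcon
        exact htN fun i hi => hcon ⟨i, hi⟩
      obtain ⟨i, hi⟩ := htN'
      have h1 : M.lookahead (vMean M δ ω Ca Cs h) s (t i).1 ≤ vMid M δ ω Ca Cs (h + 1) s t :=
        le_ciSup (f := fun i : Fin Ca => M.lookahead (vMean M δ ω Ca Cs h) s (t i).1)
          (Set.finite_range _).bddAbove i
      have h2 := lookahead_le_add hM (measurable_vStar hM hV hh.le)
        (measurable_vMean hM hV Ca Cs h) (abs_vStar_le hM hV hh.le) (abs_vMean_le hM hV Ca Cs h)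
        hle s (t i).1
      have h3 := (hmax _ hi.1).2
      have h4 : L * δ (t i).1 a' ≤ L * r := mul_le_mul_of_nonneg_left hi.2.le hL.le
      linarith
  rw [← integral_sub_vMid hM hV]
  refine (integral_mono_ae ((integrable_const _).sub (integrable_vMid hM hV Ca Cs (h + 1) s))
    ((integrable_const _).add ((integrable_const _).indicator hN)) hbound).trans ?_
  simp only [Pi.add_apply]
  rw [integral_add (integrable_const _) ((integrable_const _).indicator hN),
    integral_indicator_const _ hN]
  simp only [integral_const, probReal_univ, smul_eq_mul, one_mul]
  nlinarith

/-- The VOO regret vanishes as the number of actions grows, uniformly in everything else. -/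
theorem exists_regret_rate (hM : M.Regular Rmax) (hV : VOORegular M D δ ω L) :
    ∃ ρ : ℕ → ℝ, (∀ m, 0 ≤ ρ m) ∧ Tendsto ρ atTop (𝓝 0) ∧
      ∀ Ca Cs : ℕ, 1 ≤ Ca → RegretBound M D δ ω Ca Cs (ρ Ca) := by
  choose! κ hκ0 hκ1 hκ using exists_missRate hM hV
  -- The absolute value stands in because no state is at hand yet to show `0 ≤ Vmax`.
  obtain ⟨g, hg0, hg, hgle⟩ := exists_exploration_rate hκ0 hκ1 hV.smooth.1
    (W := 2 * |M.Vmax Rmax|) (by positivity)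
  have hγ : 0 < 1 - M.γ := by linarith [hM.γ_lt_one]
  -- `g Ca / (1 - γ)` is the fixed point of `e ↦ γ e + g Ca`, so one bound serves all levels. It
  -- also bounds the regret, as `vSup ≤ vStar`.
  have hgap : ∀ Ca Cs : ℕ, ∀ h ≤ D, ∀ s,
      M.vStar h s ≤ vMean M δ ω Ca Cs h s + g Ca / (1 - M.γ) := fun Ca Cs h => by
    have hdiv : 0 ≤ g Ca / (1 - M.γ) := div_nonneg (hg0 Ca) hγ.le
    induction h with
    | zero => intro _ s; simpa [MDP.vStar, vMean] using hdiv
    | succ h ih =>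
      intro hh s
      have h1 := hgle Ca (M.vStar (h + 1) s - vMean M δ ω Ca Cs (h + 1) s -
        M.γ * (g Ca / (1 - M.γ))) fun r hr => by
          have := vStar_succ_sub_vMean_le hM hV hh hdiv (ih (Nat.le_of_succ_le hh)) hr
            (hκ0 r hr) (hκ r hr) s
          rw [abs_of_nonneg (hM.Vmax_nonneg s)]
          linarith
      have h2 : M.γ * (g Ca / (1 - M.γ)) + g Ca = g Ca / (1 - M.γ) := by
        field_simp
        ring
      linarith
  refine ⟨fun m => g m / (1 - M.γ), fun m => div_nonneg (hg0 m) hγ.le, by simpa using hg.div_const (1 - M.γ),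
    fun Ca Cs hCa d _ s => ?_⟩
  rw [integral_sub_vMid hM hV]
  have h1 := vSup_le_vStar (δ := δ) hM hV Cs hCa (Nat.sub_le D d) s
  have h2 := hgap Ca Cs (D - d) (Nat.sub_le D d) s
  linarith

end Exploration

/-! ### Explicit sequences and their limits. -/

section Rates

theorem tendsto_maxDepth {ι : Type*} {l : Filter ι} {f : ι → ℕ → ℝ}
    (hf : ∀ d < D, Tendsto (fun m => f m d) l (𝓝 0)) :
    Tendsto (fun m => maxDepth D (f m)) l (𝓝 0) := by
  have hsum : Tendsto (fun m => ∑ d ∈ Finset.range D, |f m d|) l (𝓝 0) := by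
    have := tendsto_finsetSum (Finset.range D) fun d hd => (hf d (Finset.mem_range.1 hd)).abs
    simpa using this
  refine squeeze_zero_norm (fun m => ?_) hsum
  refine abs_iSup_le_of_finite (Finset.sum_nonneg fun _ _ => abs_nonneg _) fun d => ?_
  exact Finset.single_le_sum (f := fun d => |f m d|) (fun _ _ => abs_nonneg _)
    (Finset.mem_range.2 d.2)

/-- The constant is the fixed point of `x ↦ γ x + ρ`. Setting it to `0` at depth `D` only slackens
the inequality at `D - 1`. -/
theorem isEta_const {γ ρ : ℝ} (hγ : γ < 1) (hγ0 : 0 ≤ γ) (hρ : 0 ≤ ρ) :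
    IsEta γ D ρ fun d => if d < D then ρ / (1 - γ) else 0 := by
  have hγ' : 0 < 1 - γ := by linarith
  have h : γ * (ρ / (1 - γ)) + ρ = ρ / (1 - γ) := by
    field_simp
    ring
  have h0 : 0 ≤ ρ / (1 - γ) := div_nonneg hρ hγ'.le
  refine ⟨fun d hd => ?_, by simp⟩
  simp only [hd, if_true]
  split_ifs
  · exact h.le
  · nlinarith

theorem isAlpha_alphaCoeff (γ V ε p : ℝ) :
    IsAlpha γ V D ε p fun d => alphaCoeff γ (D - d) * (ε + 2 * p * V) := by
  constructor
  -- For `D = 0` truncated subtraction makes `D - 1 = 0`, so the base condition reads the value of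
  -- `alphaCoeff` at `0`, which is therefore `1`.
  · rcases Nat.eq_zero_or_pos D with rfl | hD
    · simp [alphaCoeff]
    · simp [show D - (D - 1) = 1 by omega, alphaCoeff]
  · intro d hd
    obtain ⟨k, hk⟩ := Nat.exists_eq_add_of_lt hd
    show alphaCoeff γ (D - d) * _ = γ * (alphaCoeff γ (D - (d + 1)) * _ + ε + 2 * p * V)
    rw [show D - d = k + 2 by omega, show D - (d + 1) = k + 1 by omega, alphaCoeff]
    ring

/-- The fourth power of the sampling tolerance used for the asymptotics. -/
def sampleScale (Ca Cs : ℕ) : ℝ := (1 + Real.log Ca + Real.log Cs) / Cs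

theorem one_le_log_add {Ca Cs : ℕ} (hCa : 1 ≤ Ca) (hCs : 1 ≤ Cs) :
    1 ≤ 1 + Real.log Ca + Real.log Cs := by
  have h1 : 0 ≤ Real.log Ca := Real.log_nonneg (by exact_mod_cast hCa)
  have h2 : 0 ≤ Real.log Cs := Real.log_nonneg (by exact_mod_cast hCs)
  linarith

theorem sampleScale_pos {Ca Cs : ℕ} (hCa : 1 ≤ Ca) (hCs : 1 ≤ Cs) : 0 < sampleScale Ca Cs :=
  div_pos (by linarith [one_le_log_add hCa hCs]) (by exact_mod_cast hCs)

theorem tendsto_sampleScale {ca cs : ℕ → ℕ} (hcs : Tendsto cs atTop atTop)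
    (hlog : Tendsto (fun m => Real.log (ca m) / cs m) atTop (𝓝 0)) :
    Tendsto (fun m => sampleScale (ca m) (cs m)) atTop (𝓝 0) := by
  have hcs' : Tendsto (fun m => (cs m : ℝ)) atTop atTop :=
    tendsto_natCast_atTop_atTop.comp hcs
  have h1 : Tendsto (fun m => 1 / (cs m : ℝ)) atTop (𝓝 0) := tendsto_const_nhds.div_atTop hcs'
  have h2 : Tendsto (fun m => Real.log (cs m) / cs m) atTop (𝓝 0) :=
    Real.isLittleO_log_id_atTop.tendsto_div_nhds_zero.comp hcs'
  have h3 := (h1.add hlog).add h2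
  simp only [add_zero] at h3
  refine h3.congr fun m => ?_
  simp only [sampleScale]
  ring

theorem actionCount_le_exp {Ca Cs : ℕ} (hCa : 1 ≤ Ca) (hCs : 1 ≤ Cs) :
    actionCount Ca Cs D ≤ D * Real.exp ((D + 1) * (1 + Real.log Ca + Real.log Cs)) := by
  have ha : (1 : ℝ) ≤ Ca := by exact_mod_cast hCa
  have hs : (1 : ℝ) ≤ Cs := by exact_mod_cast hCs
  have has : (1 : ℝ) ≤ Ca * Cs := one_le_mul_of_one_le_of_one_le ha hs
  have hexp : (Ca * Cs : ℝ) ≤ Real.exp (1 + Real.log Ca + Real.log Cs) := by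
    rw [add_assoc, Real.exp_add, Real.exp_add, Real.exp_log (by linarith),
      Real.exp_log (by linarith)]
    exact le_mul_of_one_le_left (by linarith) (Real.one_le_exp zero_le_one)
  have hterm : ∀ j ∈ Finset.range D, (Ca : ℝ) * ((Ca : ℝ) * Cs) ^ j ≤
      Real.exp ((D + 1) * (1 + Real.log Ca + Real.log Cs)) := fun j hj => by
    have h1 : (Real.exp (1 + Real.log Ca + Real.log Cs)) ^ (D + 1) =
        Real.exp ((D + 1) * (1 + Real.log Ca + Real.log Cs)) := by
      rw [← Real.exp_nat_mul]
      push_cast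
      rfl
    rw [← h1]
    calc (Ca : ℝ) * ((Ca : ℝ) * Cs) ^ j ≤ (Ca * Cs) * ((Ca : ℝ) * Cs) ^ D :=
          mul_le_mul (le_mul_of_one_le_right (by linarith) hs)
            (pow_le_pow_right₀ has (Finset.mem_range.1 hj).le) (by positivity) (by positivity)
      _ = ((Ca : ℝ) * Cs) ^ (D + 1) := by ring
      _ ≤ _ := pow_le_pow_left₀ (by positivity) hexp _
  exact (Finset.sum_le_sum hterm).trans (by simp)

/-- The sampling tolerance used for the asymptotics. -/
def sampleTol (Ca Cs : ℕ) : ℝ := √(√(sampleScale Ca Cs))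

/-- The failure probability given by the union bound and Hoeffding's inequality. -/
def failProb (D : ℕ) (V : ℝ) (Ca Cs : ℕ) : ℝ :=
  2 * actionCount Ca Cs D * Real.exp (-(2 * sampleTol Ca Cs ^ 2 * Cs / (2 * V) ^ 2))

theorem failProb_nonneg (D : ℕ) (V : ℝ) (Ca Cs : ℕ) : 0 ≤ failProb D V Ca Cs :=
  mul_nonneg (mul_nonneg zero_le_two (actionCount_nonneg _ _ _)) (Real.exp_pos _).le

/-- Put `ℓ = 1 + log Ca + log Cs`, so `sampleScale = ℓ / Cs`. The squared tolerance times `Cs` is `ℓ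
/ √sampleScale`, and the Hoeffding exponent is `B ℓ` with `B` a multiple of `1 / √sampleScale`. The
count contributes `(D + 1) ℓ`, and `ℓ ≥ 1` with `B ≥ D + 1` gives `(D + 1 - B) ℓ ≤ D + 1 - B`. -/
theorem failProb_le {Ca Cs : ℕ} (hCa : 1 ≤ Ca) (hCs : 1 ≤ Cs) {V : ℝ}
    (hy : (D + 1 : ℝ) ≤ 2 / (2 * V) ^ 2 * (√(sampleScale Ca Cs))⁻¹) :
    failProb D V Ca Cs ≤
      2 * D * Real.exp (D + 1 - 2 / (2 * V) ^ 2 * (√(sampleScale Ca Cs))⁻¹) := by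
  have hx := sampleScale_pos hCa hCs
  have hℓ := one_le_log_add hCa hCs
  have hs : (0 : ℝ) < Cs := by exact_mod_cast hCs
  have hexpo : 2 * sampleTol Ca Cs ^ 2 * Cs / (2 * V) ^ 2 = 2 / (2 * V) ^ 2 *
      (√(sampleScale Ca Cs))⁻¹ * (1 + Real.log Ca + Real.log Cs) := by
    have hy0 : 0 < √(sampleScale Ca Cs) := Real.sqrt_pos.2 hx
    have h1 : √(sampleScale Ca Cs) * Cs =
        (√(sampleScale Ca Cs))⁻¹ * (1 + Real.log Ca + Real.log Cs) := by
      have h2 : √(sampleScale Ca Cs) * √(sampleScale Ca Cs) * Cs =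
          1 + Real.log Ca + Real.log Cs := by
        rw [Real.mul_self_sqrt hx.le, sampleScale, div_mul_cancel₀ _ hs.ne']
      rw [← h2]
      field_simp
    rw [sampleTol, Real.sq_sqrt hy0.le, mul_assoc, h1]
    ring
  rw [failProb, hexpo]
  set B := 2 / (2 * V) ^ 2 * (√(sampleScale Ca Cs))⁻¹
  set ℓ := 1 + Real.log Ca + Real.log Cs with hℓdef
  calc 2 * actionCount Ca Cs D * Real.exp (-(B * ℓ))
      ≤ 2 * (D * Real.exp ((D + 1) * ℓ)) * Real.exp (-(B * ℓ)) := by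
        gcongr
        exact actionCount_le_exp hCa hCs
    _ = 2 * D * Real.exp ((D + 1) * ℓ + -(B * ℓ)) := by rw [Real.exp_add]; ring
    _ ≤ 2 * D * Real.exp (D + 1 - B) := by
        gcongr
        nlinarith

theorem tendsto_sampleTol {ca cs : ℕ → ℕ}
    (hx : Tendsto (fun m => sampleScale (ca m) (cs m)) atTop (𝓝 0)) :
    Tendsto (fun m => sampleTol (ca m) (cs m)) atTop (𝓝 0) := by
  simpa [sampleTol] using hx.sqrt.sqrt

theorem tendsto_failProb_mul (V : ℝ) {ca cs : ℕ → ℕ} (hca : ∀ m, 1 ≤ ca m)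
    (hcs : Tendsto cs atTop atTop)
    (hx : Tendsto (fun m => sampleScale (ca m) (cs m)) atTop (𝓝 0)) :
    Tendsto (fun m => failProb D V (ca m) (cs m) * V) atTop (𝓝 0) := by
  -- For `V = 0` the failure bound itself need not tend to `0`; the factor `V` removes it.
  rcases eq_or_ne V 0 with rfl | hV
  · simp
  have hpos : ∀ᶠ m in atTop, 1 ≤ cs m := hcs.eventually_ge_atTop 1
  have hy : Tendsto (fun m => √(sampleScale (ca m) (cs m))) atTop (𝓝[>] 0) := by
    refine tendsto_nhdsWithin_iff.2 ⟨by simpa using hx.sqrt, ?_⟩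
    filter_upwards [hpos] with m hm
    exact Real.sqrt_pos.2 (sampleScale_pos (hca m) hm)
  have hB : Tendsto (fun m => 2 / (2 * V) ^ 2 * (√(sampleScale (ca m) (cs m)))⁻¹) atTop atTop :=
    (tendsto_inv_nhdsGT_zero.comp hy).const_mul_atTop (by positivity)
  have hlim : Tendsto (fun m => 2 * (D : ℝ) * Real.exp (D + 1 -
      2 / (2 * V) ^ 2 * (√(sampleScale (ca m) (cs m)))⁻¹)) atTop (𝓝 (2 * (D : ℝ) * 0)) := by
    refine tendsto_const_nhds.mul (Real.tendsto_exp_atBot.comp ?_)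
    simp_rw [sub_eq_add_neg]
    exact tendsto_atBot_add_const_left _ _ (tendsto_neg_atTop_atBot.comp hB)
  have hp : Tendsto (fun m => failProb D V (ca m) (cs m)) atTop (𝓝 0) := by
    refine tendsto_of_tendsto_of_tendsto_of_le_of_le' tendsto_const_nhds
      (by simpa using hlim) (Eventually.of_forall fun m => failProb_nonneg _ _ _ _) ?_
    filter_upwards [hpos, hB.eventually_ge_atTop (D + 1 : ℝ)] with m hm hm'
    exact failProb_le (hca m) hm hm'
  simpa using hp.mul_const V

end Rates

end VOSS

end

theorem mainTheorem2 {S : Type*} [MeasurableSpace S] {n : ℕ} (M : VOSS.MDP S n) (D : ℕ)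
    (δ : VOSS.Action n → VOSS.Action n → ℝ) (ω L Rmax : ℝ)
    (hM : M.Regular Rmax) (hV : VOSS.VOORegular M D δ ω L) :
    (∀ Ca Cs : ℕ, 1 ≤ Ca → 1 ≤ Cs →
      ∀ (h : ℕ) (s : S), IsProbabilityMeasure (VOSS.treeLaw M δ ω Ca Cs h s)) ∧
    (∀ Ca Cs : ℕ, 1 ≤ Ca → 1 ≤ Cs → ∀ (ρ ε p : ℝ) (η α : ℕ → ℝ), 0 ≤ ε →
      VOSS.RegretBound M D δ ω Ca Cs ρ →
      VOSS.Concentrated M D δ ω Ca Cs ε p →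
      VOSS.IsEta M.γ D ρ η →
      VOSS.IsAlpha M.γ (M.Vmax Rmax) D ε p α →
      ∀ d < D, ∀ s : S,
        Integrable (fun t => |M.vStar (D - d) s - VOSS.vHat M Ca Cs (D - d) s t|)
          (VOSS.treeLaw M δ ω Ca Cs (D - d) s) ∧
        ∫ t, |M.vStar (D - d) s - VOSS.vHat M Ca Cs (D - d) s t|
            ∂(VOSS.treeLaw M δ ω Ca Cs (D - d) s)
          ≤ VOSS.maxDepth D η + VOSS.maxDepth D α) ∧
    (∀ Ca Cs : ℕ, 1 ≤ Ca → 1 ≤ Cs → ∀ ε p : ℝ, 0 < ε →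
      2 * (∑ j ∈ Finset.range D, (Ca : ℝ) * ((Ca : ℝ) * Cs) ^ j) *
        Real.exp (-(2 * ε ^ 2 * Cs / (2 * M.Vmax Rmax) ^ 2)) ≤ p →
      VOSS.Concentrated M D δ ω Ca Cs ε p) ∧
    (∃ (ρ : ℕ → ℝ) (η : ℕ → ℕ → ℝ) (ε p : ℕ → ℕ → ℝ) (α : ℕ → ℕ → ℕ → ℝ),
      (∀ Ca Cs : ℕ, 1 ≤ Ca → 1 ≤ Cs →
        VOSS.RegretBound M D δ ω Ca Cs (ρ Ca) ∧
        VOSS.IsEta M.γ D (ρ Ca) (η Ca) ∧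
        0 ≤ ε Ca Cs ∧ 0 ≤ p Ca Cs ∧
        VOSS.Concentrated M D δ ω Ca Cs (ε Ca Cs) (p Ca Cs) ∧
        VOSS.IsAlpha M.γ (M.Vmax Rmax) D (ε Ca Cs) (p Ca Cs) (α Ca Cs)) ∧
      Tendsto (fun Ca => VOSS.maxDepth D (η Ca)) atTop (𝓝 0) ∧
      ∀ ca cs : ℕ → ℕ, (∀ m, 1 ≤ ca m) → Tendsto cs atTop atTop →
        Tendsto (fun m => Real.log (ca m) / cs m) atTop (𝓝 0) →
        Tendsto (fun m => VOSS.maxDepth D (α (ca m) (cs m))) atTop (𝓝 0)) := by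

  refine ⟨fun Ca Cs _ _ h s => (VOSS.markovFamily_treeLaw hM hV Ca Cs h).prob s,
    fun Ca Cs hCa _ ρ ε p η α hε hρ hp hη hα d hd s =>
      VOSS.integral_abs_vStar_sub_vHat_le hM hV hCa hε hρ hp hη hα hd s,
    fun Ca Cs _ hCs ε p hε hp => VOSS.concentrated_of_le hM hV hCs hε.le hp, ?_⟩
  obtain ⟨ρ, hρ0, hρ, hreg⟩ := VOSS.exists_regret_rate hM hV
  refine ⟨ρ, fun Ca d => if d < D then ρ Ca / (1 - M.γ) else 0, VOSS.sampleTol,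
    VOSS.failProb D (M.Vmax Rmax), fun Ca Cs d => VOSS.alphaCoeff M.γ (D - d) *
      (VOSS.sampleTol Ca Cs + 2 * VOSS.failProb D (M.Vmax Rmax) Ca Cs * M.Vmax Rmax),
    fun Ca Cs hCa hCs => ⟨hreg Ca Cs hCa, VOSS.isEta_const hM.γ_lt_one hM.γ_nonneg (hρ0 Ca),
      Real.sqrt_nonneg _, VOSS.failProb_nonneg _ _ _ _,
      VOSS.concentrated_of_le hM hV hCs (Real.sqrt_nonneg _) le_rfl,
      VOSS.isAlpha_alphaCoeff _ _ _ _⟩,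
    VOSS.tendsto_maxDepth fun d hd => ?_, fun ca cs hca hcs hlog =>
      VOSS.tendsto_maxDepth fun d _ => ?_⟩
  · simpa [hd] using hρ.div_const (1 - M.γ)
  · have hx := VOSS.tendsto_sampleScale hcs hlog
    have h1 := (VOSS.tendsto_sampleTol hx).add
      ((VOSS.tendsto_failProb_mul (D := D) (M.Vmax Rmax) hca hcs hx).const_mul 2)
    have h2 := h1.const_mul (VOSS.alphaCoeff M.γ (D - d))
    simpa [mul_assoc] using h2
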